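/- Let $(s_j)_{j\ge 0}$ be a sequence of independent real random variables on a probability space with $\mathbb{E}s_j=0$ and $\mathbb{E}s_j^2=1$ for all $j$. For $n\ge1$ let $S_n$ be the $n\times n$ skew-circulant matrix with $(i,j)$ entry ($0\le i,j\le n-1$) $$(S_n)_{ij}=\begin{cases} s_{j-i}, & i\le j,\\ -s_{n+j-i}, & i>j.\end{cases}$$ (i) Suppose that $\sup_{j}\mathbb{E}|s_j|^k<\infty$ for every $k\in\mathbb{N}$. Then $n^{-1/2}S_n$ converges in $*$-distribution to a standard complex Gaussian variable as $n\to\infty$. Here $n^{-1/2}S_n$ is regarded as an element of the $*$-probability space $(\mathcal{M}_n,\varphi_n)$, where $\mathcal{M}_n$ is the $*$-algebra of random $n\times n$ complex matrices whose entries have finite moments of all orders and $\varphi_n=n^{-1}\mathbb{E}\,\mathrm{Tr}$. That is, there are a unital complex $*$-algebra $\mathcal{A}$, a linear functional $\varphi$ on $\mathcal{A}$ with $\varphi(1)=1$, and a normal, non-self-adjoint element $a\in\mathcal{A}$ with $$\varphi\big(a^k(a^*)^l\big)=\mathbb{E}\big[N^k\,\overline{N}^{\,l}\big]\quad (k,l\ge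 0),\qquad N=X+\mathrm{i}Y,\quad X,Y \text{ independent } \mathcal{N}(0,1/2),$$ such that for every monomial $Q$ in the non-commuting indeterminates $x,x^*$, $$\lim_{n\to\infty}\varphi_n\big(Q(n^{-1/2}S_n)\big)=\varphi\big(Q(a)\big).$$ (ii) Suppose that $\sup_{j}\mathbb{E}|s_j|^{2+\delta}<\infty$ for some $\delta>0$. Let $\mu_n=\frac1n\sum_{k=1}^{n}\delta_{(\mathrm{Re}\,\lambda_k,\,\mathrm{Im}\,\lambda_k)}$ be the empirical spectral distribution on $\mathbb{R}^2$ of $n^{-1/2}S_n$, where $\lambda_1,\dots,\lambda_n$ are the eigenvalues of $n^{-1/2}S_n$ counted with algebraic multiplicity. Then, as $n\to\infty$, $\mu_n$ converges weakly in probability to the bivariate Gaussian distribution $\gamma$ with mean $0$ and covariance matrix $\frac12 I_2$; that is, for every bounded continuous $f:\mathbb{R}^2\to\mathbb{R}$, $\int f\,d\mu_n\to\int f\,d\gamma$ in probability. -/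

import Mathlib

open MeasureTheory ProbabilityTheory Filter Topology
open scoped ENNReal NNReal BoundedContinuousFunction

universe u v

namespace SkewCirculant

/-- A non-commutative `*`-probability space: a unital complex `*`-algebra together with a
complex linear functional that sends `1` to `1` (called a state). -/
structure NCP where
  carrier : Type u
  [ring : Ring carrier]
  [starRing : StarRing carrier]
  [algebra : Algebra ℂ carrier]
  [starModule : StarModule ℂ carrier]
  state : carrier →ₗ[ℂ] ℂ
  state_one : state 1 = 1

instance : CoeSort NCP.{u} (Type u) := ⟨NCP.carrier⟩

attribute [instance] NCP.ring NCP.starRing NCP.algebra NCP.starModule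

/-- The value at `a` of the monomial in the non-commuting indeterminates `x`, `x^*` that is
encoded by a word: the letter `false` stands for `x`, the letter `true` stands for `x^*`. -/
def monomialEval {A : Type u} [Monoid A] [Star A] (w : List Bool) (a : A) : A :=
  (w.map fun b => if b then star a else a).prod

/-- Convergence in `*`-distribution: `φ_n(Q(a_n)) → φ(Q(a))` for every monomial `Q` in
`x`, `x^*`. -/
def TendstoInStarDistribution (𝒜 : ℕ → NCP.{u}) (a : ∀ n, 𝒜 n) (ℬ : NCP.{v}) (b : ℬ) : Prop :=
  ∀ w : List Bool,
    Tendsto (fun n => (𝒜 n).state (monomialEval w (a n))) atTop (𝓝 (ℬ.state (monomialEval w b)))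

/-- The law on `ℂ` of `X + i Y` with `X`, `Y` independent real Gaussian random variables of
mean `0` and variance `1/2`. -/
noncomputable def stdComplexGaussianLaw : Measure ℂ :=
  ((gaussianReal 0 (1 / 2)).prod (gaussianReal 0 (1 / 2))).map
    fun p : ℝ × ℝ => (p.1 : ℂ) + (p.2 : ℂ) * Complex.I

/-- A standard complex Gaussian variable of a `*`-probability space: a normal, non-self-adjoint
element `a` whose moments `φ(a^k (a^*)^l)` are `E[N^k (conj N)^l]`, where `N` is a standard
complex Gaussian random variable. -/
structure IsStdComplexGaussian (𝒜 : NCP.{u}) (a : 𝒜) : Prop where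
  normal : a * star a = star a * a
  not_selfAdjoint : star a ≠ a
  moments : ∀ k l : ℕ, 𝒜.state (a ^ k * star a ^ l) =
    ∫ z : ℂ, z ^ k * (starRingEnd ℂ z) ^ l ∂stdComplexGaussianLaw

section RandomMatrices

variable {Ω : Type u} [MeasurableSpace Ω]

/-- The `*`-algebra `ℳ_n` of random `n × n` complex matrices all of whose entries have finite
moments of all orders; `*` is the conjugate transpose. -/
def momentMatrices (μ : Measure Ω) [IsProbabilityMeasure μ] (n : ℕ) :
    StarSubalgebra ℂ (Ω → Matrix (Fin n) (Fin n) ℂ) where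
  carrier := {X | ∀ i j, ∀ p : ℕ, MemLp (fun ω => X ω i j) p μ}
  mul_mem' := by
    intro X Y hX hY i j p
    have h : (fun ω => (X * Y) ω i j) = fun ω => ∑ k, X ω i k * Y ω k j := by
      funext ω
      simp [Matrix.mul_apply]
    rw [h]
    refine memLp_finsetSum _ fun k _ => ?_
    have : ENNReal.HolderTriple ((2 * p : ℕ) : ℝ≥0∞) ((2 * p : ℕ) : ℝ≥0∞) (p : ℝ≥0∞) := by
      constructor
      push_cast
      rw [ENNReal.mul_inv (by simp) (by simp), ← add_mul, ENNReal.inv_two_add_inv_two, one_mul]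
    exact (hY k j (2 * p)).mul' (hX i k (2 * p))
  one_mem' := by
    intro i j p
    exact memLp_const _
  add_mem' := by
    intro X Y hX hY i j p
    exact (hX i j p).add (hY i j p)
  zero_mem' := by
    intro i j p
    exact memLp_const _
  algebraMap_mem' := by
    intro c i j p
    exact memLp_const _
  star_mem' := by
    intro X hX i j p
    exact (hX j i p).star

/-- The `*`-probability space `(ℳ_n, n⁻¹ E Tr)`, for `n ≥ 1`. -/
noncomputable def randomMatrixNCP (μ : Measure Ω) [IsProbabilityMeasure μ] (n : ℕ) [NeZero n] :
    NCP.{u} where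
  carrier := momentMatrices μ n
  state :=
    { toFun := fun X => (n : ℂ)⁻¹ * ∫ ω, (X.1 ω).trace ∂μ
      map_add' := by
        intro X Y
        have hint : ∀ Z : momentMatrices μ n, Integrable (fun ω => (Z.1 ω).trace) μ := by
          intro Z
          refine integrable_finsetSum _ fun i _ => ?_
          exact memLp_one_iff_integrable.1 (by simpa using Z.2 i i 1)
        rw [← mul_add, ← integral_add (hint X) (hint Y)]
        simp [Matrix.trace_add]
      map_smul' := by
        intro c X
        have h : ∀ ω, ((c • X).1 ω).trace = c * (X.1 ω).trace := by
          intro ω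
          change (c • X.1 ω).trace = _
          rw [Matrix.trace_smul, smul_eq_mul]
        simp only [h, integral_const_mul, smul_eq_mul, RingHom.id_apply]
        ring }
  state_one := by
    simp

/-- The skew-circulant matrix `Scirc(s_0, …, s_{n-1})`: constant along the diagonals, with first
row `s_0, …, s_{n-1}`, and with the signs of the entries below the main diagonal changed. -/
def scirc {R : Type v} [Neg R] (n : ℕ) (s : ℕ → R) : Matrix (Fin n) (Fin n) R :=
  Matrix.of fun i j =>
    if i ≤ j then s ((j : ℕ) - (i : ℕ)) else -s (n + (j : ℕ) - (i : ℕ))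

/-- The random matrix `n^{-1/2} S_n` with `S_n = Scirc(s_0, …, s_{n-1})`, as a matrix over `ℂ`. -/
noncomputable def scaledScirc (s : ℕ → Ω → ℝ) (n : ℕ) (ω : Ω) : Matrix (Fin n) (Fin n) ℂ :=
  (((Real.sqrt n)⁻¹ : ℝ) : ℂ) • scirc n fun j => ((s j ω : ℝ) : ℂ)

/-- Independent real random variables with mean `0` and variance `1`. -/
structure IndepStandardized (s : ℕ → Ω → ℝ) (μ : Measure Ω) : Prop where
  measurable : ∀ j, Measurable (s j)
  indep : iIndepFun s μ
  mean_zero : ∀ j, ∫ ω, s j ω ∂μ = 0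
  var_one : ∀ j, ∫ ω, s j ω ^ 2 ∂μ = 1

/-- Independent, mean `0`, variance `1`, and for every `k` the absolute moments of
order `k` are uniformly bounded. -/
structure StandardizedAllMoments (s : ℕ → Ω → ℝ) (μ : Measure Ω) : Prop extends IndepStandardized s μ where
  moments_bdd : ∀ k : ℕ, ∃ C : ℝ≥0, ∀ j, ∫⁻ ω, ‖s j ω‖ₑ ^ k ∂μ ≤ C

/-- Independent, mean `0`, variance `1`, and for some `δ > 0` the absolute moments
of order `2 + δ` are uniformly bounded. -/
structure StandardizedTwoPlusMoment (s : ℕ → Ω → ℝ) (μ : Measure Ω) : Prop extends IndepStandardized s μ where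
  moment_bdd : ∃ δ : ℝ, 0 < δ ∧ ∃ C : ℝ≥0, ∀ j, ∫⁻ ω, ‖s j ω‖ₑ ^ (2 + δ) ∂μ ≤ C

theorem scaledScirc_mem {s : ℕ → Ω → ℝ} {μ : Measure Ω} [IsProbabilityMeasure μ]
    (hs : StandardizedAllMoments s μ) (n : ℕ) : scaledScirc s n ∈ momentMatrices μ n := by
  have key : ∀ (k p : ℕ), MemLp (fun ω => ((s k ω : ℝ) : ℂ)) p μ := by
    intro k p
    refine MemLp.ofReal ?_
    rcases Nat.eq_zero_or_pos p with rfl | hp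
    · simpa using (hs.measurable k).aestronglyMeasurable
    · refine ⟨(hs.measurable k).aestronglyMeasurable, ?_⟩
      obtain ⟨C, hC⟩ := hs.moments_bdd p
      rw [eLpNorm_lt_top_iff_lintegral_rpow_enorm_lt_top (by simp; omega) (by simp)]
      simpa using (hC k).trans_lt ENNReal.coe_lt_top
  intro i j p
  unfold scaledScirc scirc
  by_cases h : i ≤ j
  · simpa [h] using (key (j - i) p).const_mul ((((Real.sqrt n)⁻¹ : ℝ) : ℂ))
  · simpa [h] using ((key (n + j - i) p).neg).const_mul ((((Real.sqrt n)⁻¹ : ℝ) : ℂ))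

/-- `n^{-1/2} S_n` as an element of `(ℳ_n, n⁻¹ E Tr)`. -/
noncomputable def scaledScircElem {s : ℕ → Ω → ℝ} {μ : Measure Ω} [IsProbabilityMeasure μ]
    (hs : StandardizedAllMoments s μ) (n : ℕ) [NeZero n] : randomMatrixNCP μ n :=
  ⟨scaledScirc s n, scaledScirc_mem hs n⟩

end RandomMatrices

/-- The empirical spectral distribution on `ℝ²` of an `n × n` complex matrix: mass `1/n` at the
point `(Re λ, Im λ)` for each eigenvalue `λ`, counted with algebraic multiplicity. -/
noncomputable def esd {n : ℕ} (A : Matrix (Fin n) (Fin n) ℂ) :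
    Measure (EuclideanSpace ℝ (Fin 2)) :=
  (n : ℝ≥0∞)⁻¹ • (A.charpoly.roots.map fun z => Measure.dirac !₂[z.re, z.im]).sum

/-- Weak convergence in probability of random measures `ν_n` to a deterministic measure `ν`:
`∫ f dν_n → ∫ f dν` in probability, for every bounded continuous real function `f`. -/
def TendstoWeaklyInProbability {Ω : Type u} [MeasurableSpace Ω] {E : Type v} [MeasurableSpace E]
    [TopologicalSpace E] (μ : Measure Ω) (ν : ℕ → Ω → Measure E) (ν_lim : Measure E) : Prop :=
  ∀ f : E →ᵇ ℝ,
    TendstoInMeasure μ (fun n ω => ∫ x, f x ∂(ν n ω)) atTop fun _ => ∫ x, f x ∂ν_lim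

end SkewCirculant

open SkewCirculant

/-! Every skew-circulant matrix is diagonalized by one fixed unitary matrix, whose columns are the
normalized powers of the roots `ζ_k` of `z ^ n = -1` (`smul_scirc_eq`). The eigenvalues of the
scaled matrix are therefore `λ_k = n^{-1/2} ∑ s_j ζ_k ^ j`, weighted sums of independent variables,
and both claims concern the family `λ_k` only.

The central object is `pairLaw`, the law of `(λ_k, λ_l)` with `k`, `l` uniform and independent of
each other and of the `s_j`. Unless `l = k`, `ζ_l` is the conjugate of `ζ_k`, or one of the two
roots is real, the real linear forms in `(λ_k, λ_l)` have exactly the variances of two independent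
standard complex Gaussians, because all oscillating sums are full geometric sums over nontrivial
roots of unity. A Lyapunov estimate then bounds the error in the characteristic function. The
exceptional pairs are `O(n)` among `n ^ 2`, so `pairLaw` converges weakly to the product law
(`tendsto_integral_pairLaw`).

For (ii), let `g` be `f` minus its Gaussian mean. The second moment of `∫ g dμ_n` is the integral of
`g ⊗ g` against `pairLaw`, which tends to `(∫ g dγ) ^ 2 = 0`; Chebyshev's inequality concludes.

For (i), the normalized expected trace of a monomial is the integral of the same monomial against
the first marginal of `pairLaw`. Monomials are unbounded, so weak convergence is supplemented by
moment bounds uniform in `n` and `k` (`exists_integral_sum_pow_le`), which give uniform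
integrability. The limit variable is realized by `1 × 1` random matrices over the Gaussian law. -/

namespace SkewCirculant

/-! ### Lyapunov-type bounds for characteristic functions. -/

section CharacteristicFunctionBounds

/-- Replace the factors one at a time; in each difference the untouched factors have norm at most
one. -/
theorem norm_prod_sub_prod_le_sum {ι : Type*} (t : Finset ι) (a b : ι → ℂ)
    (ha : ∀ i ∈ t, ‖a i‖ ≤ 1) (hb : ∀ i ∈ t, ‖b i‖ ≤ 1) :
    ‖∏ i ∈ t, a i - ∏ i ∈ t, b i‖ ≤ ∑ i ∈ t, ‖a i - b i‖ := by
  classical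
  induction t using Finset.induction_on with
  | empty => simp
  | insert i t hi ih =>
    rw [Finset.prod_insert hi, Finset.prod_insert hi, Finset.sum_insert hi]
    have h1 : ‖∏ j ∈ t, b j‖ ≤ 1 := by
      rw [norm_prod]
      exact Finset.prod_le_one (fun _ _ => norm_nonneg _)
        fun j hj => hb j (Finset.mem_insert_of_mem hj)
    have h2 := ih (fun j hj => ha j (Finset.mem_insert_of_mem hj))
      fun j hj => hb j (Finset.mem_insert_of_mem hj)
    have h3 := ha i (Finset.mem_insert_self _ _)
    calc ‖a i * ∏ j ∈ t, a j - b i * ∏ j ∈ t, b j‖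
        = ‖(a i - b i) * ∏ j ∈ t, b j + a i * (∏ j ∈ t, a j - ∏ j ∈ t, b j)‖ := by
          congr 1; ring
      _ ≤ ‖a i - b i‖ * ‖∏ j ∈ t, b j‖ + ‖a i‖ * ‖∏ j ∈ t, a j - ∏ j ∈ t, b j‖ := by
          refine (norm_add_le _ _).trans ?_
          rw [norm_mul, norm_mul]
      _ ≤ ‖a i - b i‖ * 1 + 1 * ∑ j ∈ t, ‖a j - b j‖ := by gcongr
      _ = _ := by ring

/-- For `|x| ≤ 1` the cubic Taylor remainder suffices, as `2 + δ ≤ 3`. For `|x| > 1` each term is at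
most a multiple of `x ^ 2`, and the triangle inequality is enough. -/
theorem norm_exp_I_sub_taylor_two_le {δ : ℝ} (hδ : 0 < δ) (hδ1 : δ ≤ 1) (x : ℝ) :
    ‖Complex.exp (x * Complex.I) - (1 + x * Complex.I - x ^ 2 / 2)‖ ≤ 4 * |x| ^ (2 + δ) := by
  rcases le_or_gt |x| 1 with h | h
  · have hx : ‖(x * Complex.I : ℂ)‖ = |x| := by simp
    have := Complex.exp_bound (x := x * Complex.I) (by rw [hx]; exact h) (n := 3) (by norm_num)
    rw [hx] at this
    have e : ∑ m ∈ Finset.range 3, (x * Complex.I : ℂ) ^ m / (m.factorial : ℂ)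
        = 1 + x * Complex.I - x ^ 2 / 2 := by
      simp [Finset.sum_range_succ, mul_pow]
      ring
    rw [e] at this
    refine this.trans ?_
    have h3 : |x| ^ 3 ≤ |x| ^ (2 + δ) := by
      rw [← Real.rpow_natCast]
      exact Real.rpow_le_rpow_of_exponent_ge' (abs_nonneg _) h (by linarith) (by push_cast; linarith)
    norm_num [Nat.factorial]
    nlinarith [Real.rpow_nonneg (abs_nonneg x) (2 + δ)]
  · have h2 : |x| ^ 2 ≤ |x| ^ (2 + δ) := by
      rw [← Real.rpow_natCast]
      exact Real.rpow_le_rpow_of_exponent_le h.le (by push_cast; linarith)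
    have e : ‖Complex.exp (x * Complex.I)‖ = 1 := Complex.norm_exp_ofReal_mul_I x
    have e2 : ‖(1 + x * Complex.I - x ^ 2 / 2 : ℂ)‖ ≤ 1 + |x| + |x| ^ 2 / 2 := by
      refine (norm_sub_le _ _).trans ?_
      refine add_le_add ((norm_add_le _ _).trans ?_) ?_ <;> simp
    refine (norm_sub_le _ _).trans ?_
    rw [e]
    nlinarith

theorem abs_exp_neg_sub_taylor_le {x : ℝ} (hx : 0 ≤ x) : |Real.exp (-x) - (1 - x)| ≤ x ^ 2 := by
  rcases le_or_gt x 1 with h | h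
  · have := Real.norm_exp_sub_one_sub_id_le (x := -x) (by simpa [abs_of_nonneg hx] using h)
    simp only [Real.norm_eq_abs] at this
    rw [abs_neg, sq_abs] at this
    convert this using 2
    ring
  · have h1 := Real.add_one_le_exp (-x)
    have h2 : Real.exp (-x) ≤ 1 := by simpa using hx
    rw [abs_le]
    constructor <;> nlinarith

variable {Ω : Type u} [MeasurableSpace Ω] {μ : Measure Ω} [IsProbabilityMeasure μ]

/-- Both quantities are compared with `1 - t ^ 2 / 2`, the expectation of the second-order Taylor
polynomial. -/
theorem norm_integral_exp_sub_exp_le {X : Ω → ℝ} (hX : Measurable X) {δ C : ℝ}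
    (hδ : 0 < δ) (hδ1 : δ ≤ 1) (h0 : ∫ ω, X ω ∂μ = 0) (h1 : ∫ ω, X ω ^ 2 ∂μ = 1)
    (hint : Integrable (fun ω => |X ω| ^ (2 + δ)) μ) (hC : ∫ ω, |X ω| ^ (2 + δ) ∂μ ≤ C) (t : ℝ) :
    ‖∫ ω, Complex.exp ((t * X ω : ℝ) * Complex.I) ∂μ - (Real.exp (-(t ^ 2 / 2)) : ℝ)‖
      ≤ 4 * C * |t| ^ (2 + δ) + t ^ 4 := by
  -- A non-integrable square would have integral `0` by convention, contradicting `h1`.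
  have i2 : Integrable (fun ω => X ω ^ 2) μ := by
    by_contra h
    rw [integral_undef h] at h1
    norm_num at h1
  have i1 : Integrable X μ :=
    ((memLp_two_iff_integrable_sq hX.aestronglyMeasurable).2 i2).integrable (by norm_num)
  have ie : Integrable (fun ω => Complex.exp ((t * X ω : ℝ) * Complex.I)) μ := by
    refine (integrable_const (1 : ℝ)).mono' (by fun_prop) (ae_of_all _ fun ω => ?_)
    rw [Complex.norm_exp_ofReal_mul_I]
  have i1' : Integrable (fun ω => ((t * X ω : ℝ) : ℂ) * Complex.I) μ :=
    ((i1.const_mul t).ofReal).mul_const _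
  have i2' : Integrable (fun ω => ((t * X ω : ℝ) : ℂ) ^ 2 / 2) μ := by
    have : Integrable (fun ω => (((t ^ 2 * X ω ^ 2 / 2 : ℝ)) : ℂ)) μ :=
      ((i2.const_mul _).div_const 2).ofReal
    refine this.congr (ae_of_all _ fun ω => ?_)
    push_cast
    ring
  have i3 : Integrable (fun ω => 1 + ((t * X ω : ℝ) : ℂ) * Complex.I) μ :=
    (integrable_const _).add i1'
  have i4 : Integrable
      (fun ω => 1 + ((t * X ω : ℝ) : ℂ) * Complex.I - ((t * X ω : ℝ) : ℂ) ^ 2 / 2) μ := i3.sub i2'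
  have hT : ∫ ω, (1 + ((t * X ω : ℝ) : ℂ) * Complex.I - ((t * X ω : ℝ) : ℂ) ^ 2 / 2) ∂μ
      = ((1 - t ^ 2 / 2 : ℝ) : ℂ) := by
    rw [integral_sub i3 i2', integral_add (integrable_const _) i1',
      integral_mul_const, integral_complex_ofReal, integral_const_mul, h0]
    have : ∀ ω, ((t * X ω : ℝ) : ℂ) ^ 2 / 2 = ((t ^ 2 / 2 * X ω ^ 2 : ℝ) : ℂ) := by
      intro ω; push_cast; ring
    simp_rw [this]
    rw [integral_complex_ofReal, integral_const_mul, h1]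
    simp
  have hA : ‖∫ ω, Complex.exp ((t * X ω : ℝ) * Complex.I) ∂μ - ((1 - t ^ 2 / 2 : ℝ) : ℂ)‖
      ≤ 4 * C * |t| ^ (2 + δ) := by
    rw [← hT, ← integral_sub ie i4]
    have ib : Integrable (fun ω => 4 * |t| ^ (2 + δ) * |X ω| ^ (2 + δ)) μ := hint.const_mul _
    refine (norm_integral_le_of_norm_le ib (ae_of_all _ fun ω => ?_)).trans ?_
    · refine (norm_exp_I_sub_taylor_two_le hδ hδ1 _).trans_eq ?_
      rw [abs_mul, Real.mul_rpow (abs_nonneg _) (abs_nonneg _)]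
      ring
    · rw [integral_const_mul]
      have := mul_le_mul_of_nonneg_left hC
        (show 0 ≤ 4 * |t| ^ (2 + δ) by positivity)
      linarith
  have hB : ‖((1 - t ^ 2 / 2 : ℝ) : ℂ) - (Real.exp (-(t ^ 2 / 2)) : ℝ)‖ ≤ t ^ 4 := by
    rw [← Complex.ofReal_sub, Complex.norm_real, Real.norm_eq_abs, abs_sub_comm]
    refine (abs_exp_neg_sub_taylor_le (by positivity)).trans ?_
    nlinarith [sq_nonneg (t ^ 2)]
  exact (norm_sub_le_norm_sub_add_norm_sub _ _ _).trans (add_le_add hA hB)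

/-- Quantitative Lyapunov estimate for the characteristic function of a weighted sum of
independent standardized variables. -/
theorem norm_integral_exp_sum_sub_exp_le {s : ℕ → Ω → ℝ} (hs : IndepStandardized s μ) {δ C : ℝ}
    (hδ : 0 < δ) (hδ1 : δ ≤ 1)
    (hint : ∀ j, Integrable (fun ω => |s j ω| ^ (2 + δ)) μ)
    (hC : ∀ j, ∫ ω, |s j ω| ^ (2 + δ) ∂μ ≤ C) (n : ℕ) (t : Fin n → ℝ) :
    ‖∫ ω, Complex.exp ((∑ j, t j * s j ω : ℝ) * Complex.I) ∂μ
        - (Real.exp (-((∑ j, t j ^ 2) / 2)) : ℝ)‖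
      ≤ ∑ j, (4 * C * |t j| ^ (2 + δ) + t j ^ 4) := by
  have hind : iIndepFun (fun j : Fin n => s j) μ := hs.indep.precomp Fin.val_injective
  have h1 : ∫ ω, Complex.exp ((∑ j, t j * s j ω : ℝ) * Complex.I) ∂μ
      = ∏ j : Fin n, ∫ ω, Complex.exp ((t j * s j ω : ℝ) * Complex.I) ∂μ := by
    rw [← hind.integral_fun_prod_comp
      (f := fun j x => Complex.exp ((t j * x : ℝ) * Complex.I))
      (fun j => (hs.measurable j).aemeasurable) (fun j => by fun_prop)]
    refine integral_congr_ae (ae_of_all _ fun ω => ?_)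
    simp only
    rw [← Complex.exp_sum, Complex.ofReal_sum, Finset.sum_mul]
  have h2 : ((Real.exp (-((∑ j, t j ^ 2) / 2)) : ℝ) : ℂ)
      = ∏ j : Fin n, ((Real.exp (-(t j ^ 2 / 2)) : ℝ) : ℂ) := by
    rw [← Complex.ofReal_prod, ← Real.exp_sum, Finset.sum_neg_distrib, Finset.sum_div]
  rw [h1, h2]
  refine (norm_prod_sub_prod_le_sum _ _ _ (fun j _ => ?_) (fun j _ => ?_)).trans
    (Finset.sum_le_sum fun j _ => norm_integral_exp_sub_exp_le (hs.measurable j) hδ hδ1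
      (hs.mean_zero j) (hs.var_one j) (hint j) (hC j) (t j))
  · refine (norm_integral_le_of_norm_le_const (C := 1) (ae_of_all _ fun ω => ?_)).trans (by simp)
    rw [Complex.norm_exp_ofReal_mul_I]
  · rw [Complex.norm_real, Real.norm_eq_abs, abs_of_pos (Real.exp_pos _)]
    simp only [Real.exp_le_one_iff, Left.neg_nonpos_iff]
    positivity

/-- The Taylor estimate needs `δ ≤ 1`. Lowering the exponent to `min δ 1` is harmless on a
probability space, since the smaller power is at most one plus the larger. -/
theorem StandardizedTwoPlusMoment.exists_integral_le {s : ℕ → Ω → ℝ}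
    (hs : StandardizedTwoPlusMoment s μ) :
    ∃ δ C : ℝ, 0 < δ ∧ δ ≤ 1 ∧ (∀ j, Integrable (fun ω => |s j ω| ^ (2 + δ)) μ) ∧
      ∀ j, ∫ ω, |s j ω| ^ (2 + δ) ∂μ ≤ C := by
  obtain ⟨δ, hδ, C, hC⟩ := hs.moment_bdd
  have key : ∀ j, ∫⁻ ω, ‖|s j ω| ^ (2 + min δ 1)‖ₑ ∂μ ≤ 1 + C := by
    intro j
    calc ∫⁻ ω, ‖|s j ω| ^ (2 + min δ 1)‖ₑ ∂μ ≤ ∫⁻ ω, (1 + ‖s j ω‖ₑ ^ (2 + δ)) ∂μ := by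
          refine lintegral_mono fun ω => ?_
          have hm : 0 < min δ 1 := lt_min hδ one_pos
          rw [Real.enorm_rpow_of_nonneg (abs_nonneg _) (by linarith), Real.enorm_abs]
          rcases le_total ‖s j ω‖ₑ 1 with h | h
          · exact (ENNReal.rpow_le_one h (by linarith)).trans le_self_add
          · exact (ENNReal.rpow_le_rpow_of_exponent_le h (by linarith [min_le_left δ 1])).trans
              le_add_self
      _ ≤ 1 + C := by
          rw [lintegral_add_left measurable_const]
          simpa using hC j
  have hint : ∀ j, Integrable (fun ω => |s j ω| ^ (2 + min δ 1)) μ := by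
    intro j
    refine ⟨?_, (key j).trans_lt (by simp)⟩
    exact ((hs.measurable j).abs.pow_const _).aestronglyMeasurable
  refine ⟨min δ 1, 1 + C, lt_min hδ one_pos, min_le_right _ _, hint, fun j => ?_⟩
  have hn : 0 ≤ᵐ[μ] fun ω => |s j ω| ^ (2 + min δ 1) :=
    ae_of_all _ fun ω => Real.rpow_nonneg (abs_nonneg _) _
  rw [integral_eq_lintegral_of_nonneg_ae hn (hint j).aestronglyMeasurable]
  refine ENNReal.toReal_le_of_le_ofReal (by positivity) ?_
  rw [ENNReal.ofReal_add zero_le_one C.coe_nonneg]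
  simp only [ENNReal.ofReal_one, ENNReal.ofReal_coe_nnreal]
  refine le_trans (lintegral_mono fun ω => ?_) (key j)
  rw [← ofReal_norm, Real.norm_of_nonneg (Real.rpow_nonneg (abs_nonneg _) _)]

omit [IsProbabilityMeasure μ] in
theorem StandardizedAllMoments.standardizedTwoPlusMoment {s : ℕ → Ω → ℝ}
    (hs : StandardizedAllMoments s μ) : StandardizedTwoPlusMoment s μ := by
  refine ⟨hs.toIndepStandardized, 1, one_pos, ?_⟩
  obtain ⟨C, hC⟩ := hs.moments_bdd 3
  refine ⟨C, fun j => le_trans (le_of_eq ?_) (hC j)⟩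
  congr with ω
  rw [← ENNReal.rpow_natCast]
  norm_num

end CharacteristicFunctionBounds

/-! ### Unitary diagonalization of skew-circulant matrices. -/

section Diagonalization

/-- The `n`-th roots of `-1`. -/
noncomputable def rootNegOne (n : ℕ) (k : Fin n) : ℂ :=
  Complex.exp (2 * Real.pi * Complex.I / (2 * n : ℕ)) ^ (2 * (k : ℕ) + 1)

theorem isPrimitiveRoot_exp_two_mul (n : ℕ) (hn : n ≠ 0) :
    IsPrimitiveRoot (Complex.exp (2 * Real.pi * Complex.I / (2 * n : ℕ))) (2 * n) :=
  Complex.isPrimitiveRoot_exp _ (by omega)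

theorem rootNegOne_pow {n : ℕ} (k : Fin n) : rootNegOne n k ^ n = -1 := by
  have hn : n ≠ 0 := by have := k.2; omega
  have h := isPrimitiveRoot_exp_two_mul n hn
  have h1 : Complex.exp (2 * Real.pi * Complex.I / (2 * n : ℕ)) ^ n = -1 := by
    have := h.pow (by omega) (show 2 * n = n * 2 by ring)
    exact this.eq_neg_one_of_two_right
  rw [rootNegOne, pow_right_comm, h1, pow_succ, pow_mul]
  simp

theorem norm_rootNegOne {n : ℕ} (k : Fin n) : ‖rootNegOne n k‖ = 1 := by
  have hn : n ≠ 0 := by have := k.2; omega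
  refine Complex.norm_eq_one_of_pow_eq_one (n := 2 * n) ?_ (by omega)
  rw [mul_comm, pow_mul, rootNegOne_pow]
  norm_num

theorem rootNegOne_ne_zero {n : ℕ} (k : Fin n) : rootNegOne n k ≠ 0 := by
  rw [← norm_ne_zero_iff, norm_rootNegOne]
  exact one_ne_zero

theorem conj_rootNegOne {n : ℕ} (k : Fin n) :
    starRingEnd ℂ (rootNegOne n k) = (rootNegOne n k)⁻¹ :=
  (Complex.inv_eq_conj (norm_rootNegOne k)).symm

theorem rootNegOne_injective (n : ℕ) : Function.Injective (rootNegOne n) := by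
  intro k l h
  have hn : n ≠ 0 := by have := k.2; omega
  have := (isPrimitiveRoot_exp_two_mul n hn).pow_inj (by omega) (by omega) h
  exact Fin.ext (by omega)

theorem rootNegOne_mul_ne_one {n : ℕ} {k l : Fin n} (h : (k : ℕ) + l + 1 ≠ n) :
    rootNegOne n k * rootNegOne n l ≠ 1 := by
  intro e
  have hn : n ≠ 0 := by have := k.2; omega
  rw [rootNegOne, rootNegOne, ← pow_add, (isPrimitiveRoot_exp_two_mul n hn).pow_eq_one_iff_dvd] at e
  obtain ⟨c, hc⟩ := e
  have hk := k.2
  have hl := l.2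
  -- The exponent `2 (k + l + 1)` lies strictly between `0` and `4 n`, so the only multiple of `2 n`
  -- it can equal is `2 n` itself.
  have h1 : c < 2 := by
    by_contra! h2
    nlinarith
  interval_cases c <;> omega

theorem sum_pow_eq_zero {n : ℕ} {z : ℂ} (hz : z ^ n = 1) (h1 : z ≠ 1) :
    ∑ j : Fin n, z ^ (j : ℕ) = 0 := by
  rw [Fin.sum_univ_eq_sum_range (fun j => z ^ j), geom_sum_eq h1, hz, sub_self, zero_div]

/-- The eigenvalues of the skew-circulant matrix with first row `s`. -/
noncomputable def scircEigenvalue (n : ℕ) (s : ℕ → ℂ) (k : Fin n) : ℂ :=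
  ∑ j : Fin n, s j * rootNegOne n k ^ (j : ℕ)

/-- The unitary matrix of normalized eigenvectors of skew-circulant matrices. -/
noncomputable def scircEigenbasis (n : ℕ) : Matrix (Fin n) (Fin n) ℂ :=
  Matrix.of fun i k => (((Real.sqrt n)⁻¹ : ℝ) : ℂ) * rootNegOne n k ^ (i : ℕ)

theorem star_scircEigenbasis_mul_self (n : ℕ) :
    star (scircEigenbasis n) * scircEigenbasis n = 1 := by
  ext k l
  have hn : n ≠ 0 := by have := k.2; omega
  have hs : ((((Real.sqrt n)⁻¹ : ℝ) : ℂ)) * (((Real.sqrt n)⁻¹ : ℝ) : ℂ) = (n : ℂ)⁻¹ := by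
    rw [← Complex.ofReal_mul, ← mul_inv, Real.mul_self_sqrt (by positivity)]
    simp
  have h1 : ∀ i : Fin n, star (scircEigenbasis n) k i * scircEigenbasis n i l
      = (n : ℂ)⁻¹ * ((rootNegOne n k)⁻¹ * rootNegOne n l) ^ (i : ℕ) := by
    intro i
    rw [Matrix.star_apply]
    simp only [scircEigenbasis, Matrix.of_apply, star_mul', star_pow]
    rw [← hs, mul_pow]
    have : star (rootNegOne n k) = (rootNegOne n k)⁻¹ := conj_rootNegOne k
    rw [this, Complex.star_def, Complex.conj_ofReal]
    ring
  rw [Matrix.mul_apply, Finset.sum_congr rfl fun i _ => h1 i, ← Finset.mul_sum]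
  by_cases h : k = l
  · subst h
    rw [inv_mul_cancel₀ (rootNegOne_ne_zero k)]
    simp [hn]
  · rw [sum_pow_eq_zero, Matrix.one_apply_ne h, mul_zero]
    · rw [mul_pow, inv_pow, rootNegOne_pow, rootNegOne_pow]
      norm_num
    · intro e
      rw [inv_mul_eq_one₀ (rootNegOne_ne_zero k)] at e
      exact h (rootNegOne_injective n e)

theorem scircEigenbasis_mul_star_self (n : ℕ) :
    scircEigenbasis n * star (scircEigenbasis n) = 1 :=
  mul_eq_one_comm.1 (star_scircEigenbasis_mul_self n)

/-- The sign below the diagonal is exactly the factor `ζ ^ n = -1` that a power of `ζ` picks up when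
the column index wraps around. -/
theorem scirc_mul_scircEigenbasis (n : ℕ) (s : ℕ → ℂ) :
    scirc n s * scircEigenbasis n =
      scircEigenbasis n * Matrix.diagonal (scircEigenvalue n s) := by
  ext i k
  have hn : 0 < n := i.pos
  rw [Matrix.mul_diagonal, Matrix.mul_apply]
  simp only [scirc, scircEigenbasis, scircEigenvalue, Matrix.of_apply]
  have : NeZero n := ⟨hn.ne'⟩
  -- The column is written as `i + m` modulo `n`, so that the entry is `± s m`; the two cases below
  -- are no wrap-around and wrap-around.
  rw [Finset.mul_sum, ← Equiv.sum_comp (Equiv.addLeft i)]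
  refine Finset.sum_congr rfl fun m _ => ?_
  change (if i ≤ i + m then s ((i + m : Fin n) - i : ℕ) else -s (n + (i + m : Fin n) - i : ℕ)) *
    (_ * rootNegOne n k ^ ((i + m : Fin n) : ℕ)) = _
  have hv : ((i + m : Fin n) : ℕ) = ((i : ℕ) + m) % n := Fin.val_add i m
  have hi := i.2
  have hm := m.2
  rcases lt_or_ge ((i : ℕ) + m) n with h | h
  · rw [Nat.mod_eq_of_lt h] at hv
    rw [if_pos (by rw [Fin.le_def]; omega), hv, Nat.add_sub_cancel_left, pow_add]
    ring
  · have h2 : ((i : ℕ) + m) % n = i + m - n := by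
      rw [Nat.mod_eq_sub_mod h, Nat.mod_eq_of_lt (by omega)]
    rw [h2] at hv
    rw [if_neg (by rw [Fin.le_def]; omega), hv, show n + ((i : ℕ) + m - n) - i = m by omega]
    have h3 : rootNegOne n k ^ (i : ℕ) * rootNegOne n k ^ (m : ℕ)
        = - rootNegOne n k ^ ((i : ℕ) + m - n) := by
      rw [← pow_add]
      conv_lhs => rw [show (i : ℕ) + m = n + (i + m - n) by omega, pow_add, rootNegOne_pow]
      ring
    linear_combination (-(((Real.sqrt n)⁻¹ : ℝ) : ℂ) * s m) * h3

theorem smul_scirc_eq (n : ℕ) (c : ℂ) (s : ℕ → ℂ) :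
    c • scirc n s = scircEigenbasis n *
      Matrix.diagonal (fun k => c * scircEigenvalue n s k) * star (scircEigenbasis n) := by
  have h : Matrix.diagonal (fun k => c * scircEigenvalue n s k)
      = c • Matrix.diagonal (scircEigenvalue n s) := by
    rw [← Matrix.diagonal_smul]; rfl
  rw [h, Matrix.mul_smul, Matrix.smul_mul, ← scirc_mul_scircEigenbasis, Matrix.mul_assoc,
    scircEigenbasis_mul_star_self, Matrix.mul_one]

/-! ### Monomials, traces and spectra under unitary conjugation. -/

section UnitaryConjugation

variable {m : Type*} [Fintype m] [DecidableEq m] {U : Matrix m m ℂ}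

theorem monomialEval_cons {A : Type*} [Monoid A] [Star A] (b : Bool) (w : List Bool) (a : A) :
    monomialEval (b :: w) a = (if b then star a else a) * monomialEval w a := by
  simp [monomialEval]

theorem monomialEval_nil {A : Type*} [Monoid A] [Star A] (a : A) :
    monomialEval [] a = 1 := by
  simp [monomialEval]

theorem monomialEval_conj (hU : star U * U = 1) (D : Matrix m m ℂ) (w : List Bool) :
    monomialEval w (U * D * star U) = U * monomialEval w D * star U := by
  induction w with
  | nil => rw [monomialEval_nil, monomialEval_nil, mul_one, mul_eq_one_comm.1 hU]
  | cons b w ih =>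
    have key : ∀ X Y : Matrix m m ℂ, (U * X * star U) * (U * Y * star U)
        = U * (X * Y) * star U := by
      intro X Y
      calc (U * X * star U) * (U * Y * star U) = U * X * (star U * U) * Y * star U := by
            simp only [mul_assoc]
        _ = _ := by rw [hU]; simp only [mul_assoc, one_mul]
    rw [monomialEval_cons, monomialEval_cons, ih]
    cases b
    · simp only [Bool.false_eq_true, if_false]
      exact key _ _
    · simp only [if_true]
      have hst : star (U * D * star U) = U * star D * star U := by
        rw [star_mul, star_mul, star_star, ← mul_assoc]
      rw [hst]
      exact key _ _

theorem monomialEval_diagonal (d : m → ℂ) (w : List Bool) :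
    monomialEval w (Matrix.diagonal d) = Matrix.diagonal fun k => monomialEval w (d k) := by
  induction w with
  | nil => simp [monomialEval_nil]
  | cons b w ih =>
    rw [monomialEval_cons, ih]
    cases b
    · simp [monomialEval_cons]
    · simp [monomialEval_cons, Matrix.star_eq_conjTranspose]

theorem trace_monomialEval_conj_diagonal (hU : star U * U = 1) (d : m → ℂ) (w : List Bool) :
    (monomialEval w (U * Matrix.diagonal d * star U)).trace = ∑ k, monomialEval w (d k) := by
  rw [monomialEval_conj hU, Matrix.trace_mul_comm, ← mul_assoc, hU, one_mul,
    monomialEval_diagonal, Matrix.trace_diagonal]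

theorem roots_charpoly_conj_diagonal (hU : star U * U = 1) (d : m → ℂ) :
    (U * Matrix.diagonal d * star U).charpoly.roots = Finset.univ.val.map d := by
  rw [Matrix.charpoly_mul_comm, ← mul_assoc, hU, one_mul, Matrix.charpoly_diagonal]
  have := Polynomial.roots_multiset_prod_X_sub_C (Finset.univ.val.map d)
  rwa [Multiset.map_map] at this

end UnitaryConjugation

/-- The point of the Euclidean plane that corresponds to a complex number. -/
noncomputable def toPlane (z : ℂ) : EuclideanSpace ℝ (Fin 2) := !₂[z.re, z.im]

theorem continuous_toPlane : Continuous toPlane := by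
  refine (PiLp.continuous_toLp 2 _).comp (continuous_pi fun i => ?_)
  fin_cases i
  · exact Complex.continuous_re
  · exact Complex.continuous_im

theorem integral_esd_conj_diagonal {n : ℕ} {U : Matrix (Fin n) (Fin n) ℂ} (hU : star U * U = 1)
    (d : Fin n → ℂ) (f : EuclideanSpace ℝ (Fin 2) →ᵇ ℝ) :
    ∫ x, f x ∂(esd (U * Matrix.diagonal d * star U)) = (n : ℝ)⁻¹ * ∑ k, f (toPlane (d k)) := by
  rw [esd, roots_charpoly_conj_diagonal hU, Multiset.map_map, integral_smul_measure]
  have h : (Multiset.map ((fun z : ℂ => Measure.dirac !₂[z.re, z.im]) ∘ d) Finset.univ.val).sum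
      = ∑ k, Measure.dirac (toPlane (d k)) := rfl
  rw [h, integral_finsetSum_measure fun k _ => f.integrable _]
  simp

end Diagonalization

/-! ### Eigenvalues of the scaled random matrix. -/

section Scaled

variable {Ω : Type u} [MeasurableSpace Ω]

/-- The eigenvalues of `n^{-1/2} S_n`. -/
noncomputable def scaledEigenvalue (s : ℕ → Ω → ℝ) (n : ℕ) (k : Fin n) (ω : Ω) : ℂ :=
  (((Real.sqrt n)⁻¹ : ℝ) : ℂ) * scircEigenvalue n (fun j => ((s j ω : ℝ) : ℂ)) k

omit [MeasurableSpace Ω] in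
theorem scaledScirc_eq (s : ℕ → Ω → ℝ) (n : ℕ) (ω : Ω) :
    scaledScirc s n ω = scircEigenbasis n *
      Matrix.diagonal (fun k => scaledEigenvalue s n k ω) * star (scircEigenbasis n) :=
  smul_scirc_eq n _ _

theorem measurable_scaledEigenvalue {s : ℕ → Ω → ℝ} (hs : ∀ j, Measurable (s j)) (n : ℕ)
    (k : Fin n) : Measurable (scaledEigenvalue s n k) := by
  unfold scaledEigenvalue scircEigenvalue
  have := hs
  fun_prop

end Scaled

/-! ### Joint law of two randomly chosen eigenvalues. -/

section PairLaw

/-- Separates the constant part of the square from four products which, for `a = ξ u ^ j` and `b = η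
v ^ j`, are geometric in `j`. -/
theorem two_mul_re_add_re_sq (a b : ℂ) :
    2 * (a.re + b.re) ^ 2
      = ‖a‖ ^ 2 + ‖b‖ ^ 2 + (a ^ 2 + 2 * (a * b) + b ^ 2 + 2 * (a * starRingEnd ℂ b)).re := by
  rw [← Complex.normSq_eq_norm_sq, ← Complex.normSq_eq_norm_sq]
  simp [Complex.normSq_apply, pow_two]
  ring

theorem sum_re_add_re_sq {n : ℕ} {u v : ℂ} (hu : ‖u‖ = 1) (hv : ‖v‖ = 1)
    (h1 : ∑ j : Fin n, (u * u) ^ (j : ℕ) = 0) (h2 : ∑ j : Fin n, (v * v) ^ (j : ℕ) = 0)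
    (h3 : ∑ j : Fin n, (u * v) ^ (j : ℕ) = 0)
    (h4 : ∑ j : Fin n, (u * starRingEnd ℂ v) ^ (j : ℕ) = 0) (ξ η : ℂ) :
    ∑ j : Fin n, ((ξ * u ^ (j : ℕ)).re + (η * v ^ (j : ℕ)).re) ^ 2
      = n * ((‖ξ‖ ^ 2 + ‖η‖ ^ 2) / 2) := by
  have h : ∀ j : Fin n, ((ξ * u ^ (j : ℕ)).re + (η * v ^ (j : ℕ)).re) ^ 2
      = (‖ξ‖ ^ 2 + ‖η‖ ^ 2) / 2 + (ξ ^ 2 * (u * u) ^ (j : ℕ) + 2 * (ξ * η) * (u * v) ^ (j : ℕ)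
        + η ^ 2 * (v * v) ^ (j : ℕ)
        + 2 * (ξ * starRingEnd ℂ η) * (u * starRingEnd ℂ v) ^ (j : ℕ)).re / 2 := by
    intro j
    have := two_mul_re_add_re_sq (ξ * u ^ (j : ℕ)) (η * v ^ (j : ℕ))
    rw [norm_mul, norm_mul, norm_pow, norm_pow, hu, hv, one_pow, mul_one, mul_one, map_mul,
      map_pow] at this
    have e : (ξ * u ^ (j : ℕ)) ^ 2 + 2 * ((ξ * u ^ (j : ℕ)) * (η * v ^ (j : ℕ)))
        + (η * v ^ (j : ℕ)) ^ 2
        + 2 * (ξ * u ^ (j : ℕ) * (starRingEnd ℂ η * (starRingEnd ℂ) v ^ (j : ℕ)))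
        = ξ ^ 2 * (u * u) ^ (j : ℕ) + 2 * (ξ * η) * (u * v) ^ (j : ℕ)
        + η ^ 2 * (v * v) ^ (j : ℕ)
        + 2 * (ξ * starRingEnd ℂ η) * (u * starRingEnd ℂ v) ^ (j : ℕ) := by
      simp only [mul_pow]
      ring
    rw [e] at this
    linarith
  rw [Finset.sum_congr rfl fun j _ => h j, Finset.sum_add_distrib,
    ← Finset.sum_div Finset.univ (fun j : Fin n => Complex.re _) 2, ← Complex.re_sum]
  simp only [Finset.sum_add_distrib, ← Finset.mul_sum, h1, h2, h3, h4]
  simp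

/-- The pairs of indices `(k, l)` for which the eigenvalues number `k` and `l` of a
skew-circulant matrix are not asymptotically independent circular variables. -/
def degeneratePairs (n : ℕ) : Finset (Fin n × Fin n) :=
  Finset.univ.filter fun p => p.1 = p.2 ∨ (p.1 : ℕ) + p.2 + 1 = n ∨
    (p.1 : ℕ) + p.1 + 1 = n ∨ (p.2 : ℕ) + p.2 + 1 = n

theorem card_degeneratePairs_le (n : ℕ) : (degeneratePairs n).card ≤ 4 * n := by
  rcases Nat.eq_zero_or_pos n with rfl | hn
  · simp [degeneratePairs]
  -- For odd `n` this is the index of the real root `-1`, the only solution of `2 k + 1 = n`. For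
  -- even `n` there is no solution, and the row and column through `c` merely enlarge the covering
  -- set.
  let c : Fin n := ⟨(n - 1) / 2, by omega⟩
  have hsub : degeneratePairs n ⊆
      ((Finset.univ.image fun k : Fin n => (k, k)) ∪
        (Finset.univ.image fun k : Fin n => (k, k.rev))) ∪
      ((Finset.univ.image fun k : Fin n => (c, k)) ∪
        (Finset.univ.image fun k : Fin n => (k, c))) := by
    rintro ⟨k, l⟩ h
    simp only [degeneratePairs, Finset.mem_filter, Finset.mem_univ, true_and] at h
    simp only [Finset.mem_union, Finset.mem_image, Finset.mem_univ, true_and, Prod.mk.injEq,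
      exists_eq_left, exists_eq_right]
    rcases h with h | h | h | h
    · exact Or.inl (Or.inl h)
    · exact Or.inl (Or.inr (Fin.ext (by rw [Fin.val_rev]; omega)))
    · exact Or.inr (Or.inl (Fin.ext (by simp only [c]; omega)))
    · exact Or.inr (Or.inr (Fin.ext (by simp only [c]; omega)))
  have him : ∀ f : Fin n → Fin n × Fin n, (Finset.univ.image f).card ≤ n := fun f =>
    Finset.card_image_le.trans (by simp)
  refine (Finset.card_le_card hsub).trans ((Finset.card_union_le _ _).trans ?_)
  have h1 := Finset.card_union_le (Finset.univ.image fun k : Fin n => (k, k))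
    (Finset.univ.image fun k : Fin n => (k, k.rev))
  have h2 := Finset.card_union_le (Finset.univ.image fun k : Fin n => (c, k))
    (Finset.univ.image fun k : Fin n => (k, c))
  have := him fun k => (k, k)
  have := him fun k => (k, k.rev)
  have := him fun k => (c, k)
  have := him fun k => (k, c)
  omega

/-- Products and quotients of two roots of `-1` are `n`-th roots of unity, and each excluded
coincidence is precisely a case where one of the four ratios would be `1`. Inverses appear because
the inner product conjugates the eigenvalue. -/
theorem sum_rootNegOne_inv_re_sq {n : ℕ} {p : Fin n × Fin n} (hp : p ∉ degeneratePairs n)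
    (ξ η : ℂ) :
    ∑ j : Fin n, ((ξ * (rootNegOne n p.1)⁻¹ ^ (j : ℕ)).re
        + (η * (rootNegOne n p.2)⁻¹ ^ (j : ℕ)).re) ^ 2
      = n * ((‖ξ‖ ^ 2 + ‖η‖ ^ 2) / 2) := by
  obtain ⟨k, l⟩ := p
  simp only [degeneratePairs, Finset.mem_filter, Finset.mem_univ, true_and, not_or] at hp
  obtain ⟨h1, h2, h3, h4⟩ := hp
  have hz : ∀ a b : Fin n, (a : ℕ) + b + 1 ≠ n →
      ∑ j : Fin n, ((rootNegOne n a)⁻¹ * (rootNegOne n b)⁻¹) ^ (j : ℕ) = 0 := by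
    intro a b hab
    refine sum_pow_eq_zero ?_ fun e => ?_
    · rw [mul_pow, inv_pow, inv_pow, rootNegOne_pow, rootNegOne_pow]
      norm_num
    · rw [← mul_inv, inv_eq_one] at e
      exact rootNegOne_mul_ne_one hab e
  refine sum_re_add_re_sq (by simp [norm_rootNegOne]) (by simp [norm_rootNegOne])
    (hz k k h3) (hz l l h4) (hz k l h2) (sum_pow_eq_zero ?_ fun e => ?_) ξ η
  · rw [map_inv₀, conj_rootNegOne, inv_inv, mul_pow, inv_pow, rootNegOne_pow, rootNegOne_pow]
    norm_num
  · rw [map_inv₀, conj_rootNegOne, inv_inv, inv_mul_eq_one₀ (rootNegOne_ne_zero k)] at e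
    exact h1 (rootNegOne_injective n e)

variable {Ω : Type u} [MeasurableSpace Ω]

omit [MeasurableSpace Ω] in
theorem inner_scaledEigenvalue (s : ℕ → Ω → ℝ) {n : ℕ} (k : Fin n) (ω : Ω) (ξ : ℂ) :
    inner ℝ (scaledEigenvalue s n k ω) ξ
      = ∑ j : Fin n, (Real.sqrt n)⁻¹ * (ξ * (rootNegOne n k)⁻¹ ^ (j : ℕ)).re * s j ω := by
  rw [Complex.inner, scaledEigenvalue, scircEigenvalue, map_mul, map_sum, Complex.conj_ofReal,
    mul_left_comm, Complex.re_ofReal_mul, Finset.mul_sum, Complex.re_sum, Finset.mul_sum]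
  refine Finset.sum_congr rfl fun j _ => ?_
  rw [map_mul, map_pow, Complex.conj_ofReal, conj_rootNegOne, mul_left_comm, Complex.re_ofReal_mul]
  ring

/-- The law of a pair of eigenvalues of `n^{-1/2} S_n` chosen uniformly and independently. -/
noncomputable def pairLaw (s : ℕ → Ω → ℝ) (μ : Measure Ω) (n : ℕ) :
    Measure (WithLp 2 (ℂ × ℂ)) :=
  ((n * n : ℕ) : ℝ≥0∞)⁻¹ • ∑ p : Fin n × Fin n,
    μ.map fun ω => WithLp.toLp 2 (scaledEigenvalue s n p.1 ω, scaledEigenvalue s n p.2 ω)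

variable {μ : Measure Ω} [IsProbabilityMeasure μ]

omit [IsProbabilityMeasure μ] in
theorem measurable_scaledEigenvalue_pair {s : ℕ → Ω → ℝ} (hs : ∀ j, Measurable (s j)) (n : ℕ)
    (p : Fin n × Fin n) : Measurable fun ω =>
      (WithLp.toLp 2 (scaledEigenvalue s n p.1 ω, scaledEigenvalue s n p.2 ω) :
        WithLp 2 (ℂ × ℂ)) := by
  have := measurable_scaledEigenvalue hs n p.1
  have := measurable_scaledEigenvalue hs n p.2
  fun_prop

theorem isProbabilityMeasure_pairLaw {s : ℕ → Ω → ℝ} (hs : ∀ j, Measurable (s j)) {n : ℕ}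
    (hn : n ≠ 0) : IsProbabilityMeasure (pairLaw s μ n) := by
  constructor
  have h : ∀ p : Fin n × Fin n, (μ.map fun ω => (WithLp.toLp 2
      (scaledEigenvalue s n p.1 ω, scaledEigenvalue s n p.2 ω) : WithLp 2 (ℂ × ℂ)))
      Set.univ = 1 := fun p => by
    rw [Measure.map_apply (measurable_scaledEigenvalue_pair hs n p) MeasurableSet.univ]
    simp
  rw [pairLaw, Measure.smul_apply, Measure.finsetSum_apply, Finset.sum_congr rfl fun p _ => h p]
  simp only [Finset.sum_const, Finset.card_univ, Fintype.card_prod, Fintype.card_fin, smul_eq_mul,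
    nsmul_eq_mul, mul_one]
  exact ENNReal.inv_mul_cancel (by simp [hn]) (ENNReal.natCast_ne_top _)

omit [IsProbabilityMeasure μ] in
theorem integral_pairLaw {s : ℕ → Ω → ℝ} (hs : ∀ j, Measurable (s j)) (n : ℕ)
    {F : Type*} [NormedAddCommGroup F] [NormedSpace ℝ F] [CompleteSpace F]
    [SecondCountableTopology F] {f : WithLp 2 (ℂ × ℂ) → F} (hf : Continuous f)
    (hint : ∀ p : Fin n × Fin n, Integrable (fun ω => f (WithLp.toLp 2
      (scaledEigenvalue s n p.1 ω, scaledEigenvalue s n p.2 ω))) μ) :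
    ∫ x, f x ∂(pairLaw s μ n) = ((n * n : ℕ) : ℝ)⁻¹ • ∑ p : Fin n × Fin n,
      ∫ ω, f (WithLp.toLp 2 (scaledEigenvalue s n p.1 ω, scaledEigenvalue s n p.2 ω)) ∂μ := by
  have hm := measurable_scaledEigenvalue_pair hs n
  rw [pairLaw, integral_smul_measure, integral_finsetSum_measure]
  · simp_rw [integral_map (hm _).aemeasurable hf.aestronglyMeasurable]
    simp
  · intro p _
    exact (integrable_map_measure hf.aestronglyMeasurable (hm p).aemeasurable).2 (hint p)

omit [IsProbabilityMeasure μ] in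
theorem integrable_pairLaw {s : ℕ → Ω → ℝ} (hs : ∀ j, Measurable (s j)) {n : ℕ} (hn : n ≠ 0)
    {F : Type*} [NormedAddCommGroup F] [NormedSpace ℝ F]
    [SecondCountableTopology F] {f : WithLp 2 (ℂ × ℂ) → F} (hf : Continuous f)
    (hint : ∀ p : Fin n × Fin n, Integrable (fun ω => f (WithLp.toLp 2
      (scaledEigenvalue s n p.1 ω, scaledEigenvalue s n p.2 ω))) μ) :
    Integrable f (pairLaw s μ n) := by
  have hm := measurable_scaledEigenvalue_pair hs n
  refine Integrable.smul_measure ?_ (by simp [hn])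
  rw [integrable_finsetSum_measure]
  intro p _
  exact (integrable_map_measure hf.aestronglyMeasurable (hm p).aemeasurable).2 (hint p)

/-- The exponent is a weighted sum of the `s j` whose squared weights add up exactly to the Gaussian
variance, so only the Lyapunov error remains; each weight is at most `n^{-1/2} (‖ξ‖ + ‖η‖)`. -/
theorem norm_charFun_pair_sub_le {s : ℕ → Ω → ℝ} (hs : IndepStandardized s μ) {δ C : ℝ}
    (hδ : 0 < δ) (hδ1 : δ ≤ 1)
    (hint : ∀ j, Integrable (fun ω => |s j ω| ^ (2 + δ)) μ)
    (hC : ∀ j, ∫ ω, |s j ω| ^ (2 + δ) ∂μ ≤ C) {n : ℕ} {p : Fin n × Fin n}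
    (hp : p ∉ degeneratePairs n) (ξ η : ℂ) :
    ‖∫ ω, Complex.exp ((inner ℝ (scaledEigenvalue s n p.1 ω) ξ
        + inner ℝ (scaledEigenvalue s n p.2 ω) η : ℝ) * Complex.I) ∂μ
        - (Real.exp (-((‖ξ‖ ^ 2 + ‖η‖ ^ 2) / 4)) : ℝ)‖
      ≤ n * (4 * C * ((Real.sqrt n)⁻¹ * (‖ξ‖ + ‖η‖)) ^ (2 + δ)
        + ((Real.sqrt n)⁻¹ * (‖ξ‖ + ‖η‖)) ^ 4) := by
  have hn : n ≠ 0 := by have := p.1.2; omega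
  set c : Fin n → ℝ := fun j => (ξ * (rootNegOne n p.1)⁻¹ ^ (j : ℕ)).re
    + (η * (rootNegOne n p.2)⁻¹ ^ (j : ℕ)).re with hc
  have hc_le : ∀ j, |c j| ≤ ‖ξ‖ + ‖η‖ := by
    intro j
    refine (abs_add_le _ _).trans (add_le_add ?_ ?_) <;>
    · refine (Complex.abs_re_le_norm _).trans_eq ?_
      rw [norm_mul, norm_pow, norm_inv, norm_rootNegOne]
      simp
  have hsq : (Real.sqrt n)⁻¹ ^ 2 = (n : ℝ)⁻¹ := by
    rw [inv_pow, Real.sq_sqrt (by positivity)]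
  have h := norm_integral_exp_sum_sub_exp_le hs hδ hδ1 hint hC n fun j => (Real.sqrt n)⁻¹ * c j
  have hsum : ∑ j, ((Real.sqrt n)⁻¹ * c j) ^ 2 = (‖ξ‖ ^ 2 + ‖η‖ ^ 2) / 2 := by
    simp_rw [mul_pow]
    rw [← Finset.mul_sum, sum_rootNegOne_inv_re_sq hp, hsq, inv_mul_cancel_left₀ (by simpa)]
  rw [hsum, show (‖ξ‖ ^ 2 + ‖η‖ ^ 2) / 2 / 2 = (‖ξ‖ ^ 2 + ‖η‖ ^ 2) / 4 by ring] at h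
  have hin : ∀ ω, inner ℝ (scaledEigenvalue s n p.1 ω) ξ
      + inner ℝ (scaledEigenvalue s n p.2 ω) η = ∑ j, (Real.sqrt n)⁻¹ * c j * s j ω := by
    intro ω
    rw [inner_scaledEigenvalue, inner_scaledEigenvalue, ← Finset.sum_add_distrib]
    exact Finset.sum_congr rfl fun j _ => by rw [hc]; ring
  simp_rw [hin]
  refine h.trans ?_
  have hC0 : 0 ≤ C := le_trans
    (integral_nonneg fun ω => Real.rpow_nonneg (abs_nonneg _) _) (hC 0)
  refine (Finset.sum_le_card_nsmul _ _ _ fun j _ => ?_).trans_eq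
    (by rw [Finset.card_univ, Fintype.card_fin, nsmul_eq_mul])
  have hle : |(Real.sqrt n)⁻¹ * c j| ≤ (Real.sqrt n)⁻¹ * (‖ξ‖ + ‖η‖) := by
    rw [abs_mul, abs_of_nonneg (a := (Real.sqrt n)⁻¹) (by positivity)]
    exact mul_le_mul_of_nonneg_left (hc_le j) (by positivity)
  refine add_le_add (mul_le_mul_of_nonneg_left
    (Real.rpow_le_rpow (abs_nonneg _) hle (by linarith)) (by positivity)) ?_
  rw [← Even.pow_abs (by decide)]
  exact pow_le_pow_left₀ (abs_nonneg _) hle 4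

/-- Average over all pairs: at most `4 n` of the `n ^ 2` are degenerate and each costs at most `2`,
whence the term `8 / n`. -/
theorem norm_charFun_pairLaw_sub_le {s : ℕ → Ω → ℝ} (hs : IndepStandardized s μ) {δ C : ℝ}
    (hδ : 0 < δ) (hδ1 : δ ≤ 1)
    (hint : ∀ j, Integrable (fun ω => |s j ω| ^ (2 + δ)) μ)
    (hC : ∀ j, ∫ ω, |s j ω| ^ (2 + δ) ∂μ ≤ C) {n : ℕ} (hn : n ≠ 0) (t : WithLp 2 (ℂ × ℂ)) :
    ‖charFun (pairLaw s μ n) t - (Real.exp (-((‖t.fst‖ ^ 2 + ‖t.snd‖ ^ 2) / 4)) : ℝ)‖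
      ≤ n * (4 * C * ((Real.sqrt n)⁻¹ * (‖t.fst‖ + ‖t.snd‖)) ^ (2 + δ)
        + ((Real.sqrt n)⁻¹ * (‖t.fst‖ + ‖t.snd‖)) ^ 4) + 8 * (n : ℝ)⁻¹ := by
  set ε : ℝ := n * (4 * C * ((Real.sqrt n)⁻¹ * (‖t.fst‖ + ‖t.snd‖)) ^ (2 + δ)
        + ((Real.sqrt n)⁻¹ * (‖t.fst‖ + ‖t.snd‖)) ^ 4) with hε
  set g : ℂ := ((Real.exp (-((‖t.fst‖ ^ 2 + ‖t.snd‖ ^ 2) / 4)) : ℝ) : ℂ) with hg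
  have hC0 : 0 ≤ C := le_trans
    (integral_nonneg fun ω => Real.rpow_nonneg (abs_nonneg _) _) (hC 0)
  have hε0 : 0 ≤ ε := by positivity
  set a : Fin n × Fin n → ℂ := fun p => ∫ ω, Complex.exp ((inner ℝ (scaledEigenvalue s n p.1 ω)
    t.fst + inner ℝ (scaledEigenvalue s n p.2 ω) t.snd : ℝ) * Complex.I) ∂μ with ha
  have hchar : charFun (pairLaw s μ n) t = ((n * n : ℕ) : ℝ)⁻¹ • ∑ p, a p := by
    rw [charFun_apply, integral_pairLaw hs.measurable n (by fun_prop)]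
    · simp [ha, WithLp.prod_inner_apply]
    · intro p
      have := measurable_scaledEigenvalue_pair hs.measurable n p
      refine (integrable_const (1 : ℝ)).mono' (Continuous.comp_aestronglyMeasurable
        (g := fun x => Complex.exp ((inner ℝ x t : ℝ) * Complex.I)) (by fun_prop)
        this.aestronglyMeasurable) (ae_of_all _ fun ω => ?_)
      rw [Complex.norm_exp_ofReal_mul_I]
  have hg1 : ‖g‖ ≤ 1 := by
    rw [hg, Complex.norm_real, Real.norm_eq_abs, abs_of_pos (Real.exp_pos _)]
    simp only [Real.exp_le_one_iff, Left.neg_nonpos_iff]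
    positivity
  have ha1 : ∀ p, ‖a p‖ ≤ 1 := by
    intro p
    refine (norm_integral_le_of_norm_le_const (C := 1) (ae_of_all _ fun ω => ?_)).trans (by simp)
    rw [Complex.norm_exp_ofReal_mul_I]
  have hp : ∀ p, ‖a p - g‖ ≤ ε + if p ∈ degeneratePairs n then 2 else 0 := by
    intro p
    split_ifs with h
    · have := norm_sub_le (a p) g
      linarith [ha1 p]
    · rw [add_zero]
      exact norm_charFun_pair_sub_le hs hδ hδ1 hint hC h _ _
  have hn' : (n : ℝ) ≠ 0 := by exact_mod_cast hn
  have hsub : charFun (pairLaw s μ n) t - g = ((n * n : ℕ) : ℝ)⁻¹ • ∑ p, (a p - g) := by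
    rw [hchar, Finset.sum_sub_distrib, smul_sub]
    congr 1
    simp only [Finset.sum_const, Finset.card_univ, Fintype.card_prod, Fintype.card_fin]
    rw [← Nat.cast_smul_eq_nsmul ℝ, smul_smul, inv_mul_cancel₀ (by simp [hn]), one_smul]
  rw [hsub, norm_smul, Real.norm_of_nonneg (by positivity)]
  have hcard : ((degeneratePairs n).card : ℝ) ≤ 4 * n := by
    exact_mod_cast card_degeneratePairs_le n
  have hfin : ‖∑ p, (a p - g)‖ ≤ (n * n) * ε + 8 * n := by
    refine (norm_sum_le _ _).trans ((Finset.sum_le_sum fun p _ => hp p).trans ?_)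
    rw [Finset.sum_add_distrib, ← Finset.sum_filter, Finset.filter_mem_eq_inter,
      Finset.univ_inter]
    simp only [Finset.sum_const, Finset.card_univ, Fintype.card_prod, Fintype.card_fin,
      nsmul_eq_mul]
    push_cast
    linarith
  calc ((n * n : ℕ) : ℝ)⁻¹ * ‖∑ p, (a p - g)‖
      ≤ ((n * n : ℕ) : ℝ)⁻¹ * ((n * n) * ε + 8 * n) := by gcongr
    _ = ε + 8 * (n : ℝ)⁻¹ := by
        push_cast
        field_simp

/-- The summands are of order `n^{-δ/2}`, `n⁻¹` and `n⁻¹`. -/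
theorem tendsto_lyapunov_error {δ : ℝ} (hδ : 0 < δ) (C M : ℝ) (hM : 0 ≤ M) :
    Tendsto (fun n : ℕ => (n : ℝ) * (4 * C * ((Real.sqrt n)⁻¹ * M) ^ (2 + δ)
        + ((Real.sqrt n)⁻¹ * M) ^ 4) + 8 * (n : ℝ)⁻¹) atTop (𝓝 0) := by
  have hinv : Tendsto (fun n : ℕ => (n : ℝ)⁻¹) atTop (𝓝 0) := tendsto_inv_atTop_nhds_zero_nat
  have hsq : Tendsto (fun n : ℕ => (Real.sqrt n)⁻¹) atTop (𝓝 0) :=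
    tendsto_inv_atTop_zero.comp (Real.tendsto_sqrt_atTop.comp tendsto_natCast_atTop_atTop)
  have hpow : Tendsto (fun n : ℕ => ((Real.sqrt n)⁻¹) ^ δ) atTop (𝓝 0) := by
    have := hsq.rpow_const (p := δ) (Or.inr hδ.le)
    rwa [Real.zero_rpow hδ.ne'] at this
  have hlim : Tendsto (fun n : ℕ => 4 * C * M ^ (2 + δ) * ((Real.sqrt n)⁻¹) ^ δ
      + M ^ 4 * (n : ℝ)⁻¹ + 8 * (n : ℝ)⁻¹) atTop (𝓝 0) := by
    simpa using ((hpow.const_mul (4 * C * M ^ (2 + δ))).add (hinv.const_mul (M ^ 4))).add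
      (hinv.const_mul 8)
  refine hlim.congr' ?_
  filter_upwards [eventually_gt_atTop 0] with n hn
  have hn' : (0 : ℝ) < n := by exact_mod_cast hn
  have hr : (Real.sqrt n)⁻¹ ^ 2 = (n : ℝ)⁻¹ := by
    rw [inv_pow, Real.sq_sqrt hn'.le]
  have hpos : 0 < (Real.sqrt n)⁻¹ := by positivity
  rw [Real.mul_rpow hpos.le hM, Real.rpow_add hpos, Real.rpow_two, hr, mul_pow,
    show (Real.sqrt n)⁻¹ ^ 4 = ((Real.sqrt n)⁻¹ ^ 2) ^ 2 by ring, hr]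
  field_simp

end PairLaw

/-! ### Weak convergence to the Gaussian law, and claim (ii). -/

section GaussianLimit

instance : IsProbabilityMeasure stdComplexGaussianLaw :=
  Measure.isProbabilityMeasure_map (by fun_prop)

theorem charFun_stdComplexGaussianLaw (ξ : ℂ) :
    charFun stdComplexGaussianLaw ξ = (Real.exp (-(‖ξ‖ ^ 2 / 4)) : ℝ) := by
  rw [charFun_apply, stdComplexGaussianLaw, integral_map (by fun_prop) (by fun_prop)]
  have h : ∀ p : ℝ × ℝ, Complex.exp ((inner ℝ ((p.1 : ℂ) + (p.2 : ℂ) * Complex.I) ξ : ℝ) *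
      Complex.I) = Complex.exp (ξ.re * p.1 * Complex.I) * Complex.exp (ξ.im * p.2 * Complex.I) := by
    intro p
    rw [← Complex.exp_add, Complex.inner]
    congr 1
    simp
    ring
  simp_rw [h]
  rw [integral_prod_mul (fun x : ℝ => Complex.exp (ξ.re * x * Complex.I))
    (fun y : ℝ => Complex.exp (ξ.im * y * Complex.I)), ← charFun_apply_real, ← charFun_apply_real,
    charFun_gaussianReal, charFun_gaussianReal, ← Complex.exp_add, Complex.ofReal_exp,
    ← Complex.normSq_eq_norm_sq, Complex.normSq_apply]
  congr 1
  push_cast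
  ring

theorem map_toPlane_stdComplexGaussianLaw :
    stdComplexGaussianLaw.map toPlane =
      multivariateGaussian 0 (Matrix.diagonal fun _ : Fin 2 => (1 / 2 : ℝ)) := by
  have := Measure.isProbabilityMeasure_map (μ := stdComplexGaussianLaw)
    continuous_toPlane.measurable.aemeasurable
  refine Measure.ext_of_charFun (funext fun t => ?_)
  have hS : (Matrix.diagonal fun _ : Fin 2 => (1 / 2 : ℝ)).PosSemidef :=
    Matrix.PosSemidef.diagonal fun _ => by norm_num
  rw [charFun_multivariateGaussian hS, charFun_apply,
    integral_map continuous_toPlane.measurable.aemeasurable (by fun_prop)]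
  have h : ∀ z : ℂ, inner ℝ (toPlane z) t = inner ℝ z (⟨t 0, t 1⟩ : ℂ) := by
    intro z
    simp [toPlane, PiLp.inner_apply, Fin.sum_univ_two, Complex.inner]
  simp_rw [h]
  rw [← charFun_apply, charFun_stdComplexGaussianLaw, Complex.ofReal_exp,
    ← Complex.normSq_eq_norm_sq, Complex.normSq_apply]
  congr 1
  simp [Matrix.mulVec_diagonal, dotProduct, Fin.sum_univ_two]
  ring

/-- The law of a pair of independent standard complex Gaussian variables. -/
noncomputable def gaussianPairLaw : Measure (WithLp 2 (ℂ × ℂ)) :=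
  (stdComplexGaussianLaw.prod stdComplexGaussianLaw).map (WithLp.toLp 2)

instance : IsProbabilityMeasure gaussianPairLaw :=
  Measure.isProbabilityMeasure_map (by fun_prop)

theorem integral_gaussianPairLaw_mul (f g : ℂ → ℝ) (hf : Continuous f) (hg : Continuous g) :
    ∫ x, f x.fst * g x.snd ∂gaussianPairLaw
      = (∫ z, f z ∂stdComplexGaussianLaw) * ∫ z, g z ∂stdComplexGaussianLaw := by
  rw [gaussianPairLaw, integral_map (by fun_prop)
    (Continuous.aestronglyMeasurable (by fun_prop))]
  exact integral_prod_mul f g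

theorem charFun_gaussianPairLaw (t : WithLp 2 (ℂ × ℂ)) :
    charFun gaussianPairLaw t = (Real.exp (-((‖t.fst‖ ^ 2 + ‖t.snd‖ ^ 2) / 4)) : ℝ) := by
  rw [gaussianPairLaw, charFun_prod, charFun_stdComplexGaussianLaw, charFun_stdComplexGaussianLaw,
    ← Complex.ofReal_mul, ← Real.exp_add]
  congr 2
  simp only [WithLp.ofLp_fst, WithLp.ofLp_snd]
  ring

variable {Ω : Type u} [MeasurableSpace Ω] {μ : Measure Ω} [IsProbabilityMeasure μ]

/-- Lévy's continuity theorem. The shift to `n + 1` keeps `pairLaw` a probability measure. -/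
theorem tendsto_integral_pairLaw {s : ℕ → Ω → ℝ} (hs : StandardizedTwoPlusMoment s μ)
    (f : WithLp 2 (ℂ × ℂ) →ᵇ ℝ) :
    Tendsto (fun n => ∫ x, f x ∂(pairLaw s μ (n + 1))) atTop (𝓝 (∫ x, f x ∂gaussianPairLaw)) := by
  obtain ⟨δ, C, hδ, hδ1, hint, hC⟩ := hs.exists_integral_le
  let ν : ℕ → ProbabilityMeasure (WithLp 2 (ℂ × ℂ)) := fun n =>
    ⟨pairLaw s μ (n + 1), isProbabilityMeasure_pairLaw hs.measurable n.succ_ne_zero⟩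
  let γ : ProbabilityMeasure (WithLp 2 (ℂ × ℂ)) := ⟨gaussianPairLaw, inferInstance⟩
  have h : Tendsto ν atTop (𝓝 γ) := by
    refine ProbabilityMeasure.tendsto_of_tendsto_charFun fun t => ?_
    change Tendsto (fun n => charFun (pairLaw s μ (n + 1)) t) atTop (𝓝 (charFun gaussianPairLaw t))
    rw [tendsto_iff_norm_sub_tendsto_zero, charFun_gaussianPairLaw]
    exact squeeze_zero (fun _ => norm_nonneg _)
      (fun n => norm_charFun_pairLaw_sub_le hs.toIndepStandardized hδ hδ1 hint hC
        n.succ_ne_zero t)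
      ((tendsto_lyapunov_error hδ C (‖t.fst‖ + ‖t.snd‖) (by positivity)).comp
        (tendsto_add_atTop_nat 1))
  exact ProbabilityMeasure.tendsto_iff_forall_integral_tendsto.1 h f

/-- Chebyshev's inequality. -/
theorem tendstoInMeasure_of_tendsto_integral_sq {X : ℕ → Ω → ℝ} {c : ℝ}
    (hint : ∀ n, Integrable (fun ω => (X n ω - c) ^ 2) μ)
    (h : Tendsto (fun n => ∫ ω, (X n ω - c) ^ 2 ∂μ) atTop (𝓝 0)) :
    TendstoInMeasure μ X atTop fun _ => c := by
  rw [tendstoInMeasure_iff_measureReal_norm]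
  intro ε hε
  have h2 : Tendsto (fun n => (∫ ω, (X n ω - c) ^ 2 ∂μ) / ε ^ 2) atTop (𝓝 0) := by
    simpa using h.div_const (ε ^ 2)
  refine squeeze_zero (fun _ => measureReal_nonneg) (fun n => ?_) h2
  rw [le_div_iff₀ (by positivity), mul_comm]
  have := mul_meas_ge_le_integral_of_nonneg (ae_of_all μ fun ω => sq_nonneg (X n ω - c))
    (hint n) (ε ^ 2)
  have hset : {ω | ε ≤ ‖X n ω - c‖} = {ω | ε ^ 2 ≤ (X n ω - c) ^ 2} := by
    ext ω
    change ε ≤ |X n ω - c| ↔ ε ^ 2 ≤ (X n ω - c) ^ 2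
    rw [← sq_abs (X n ω - c)]
    exact (pow_le_pow_iff_left₀ hε.le (abs_nonneg _) two_ne_zero).symm
  rwa [hset]

omit [MeasurableSpace Ω] in
theorem integral_esd_scaledScirc (s : ℕ → Ω → ℝ) (n : ℕ) (ω : Ω)
    (f : EuclideanSpace ℝ (Fin 2) →ᵇ ℝ) :
    ∫ x, f x ∂(esd (scaledScirc s n ω))
      = (n : ℝ)⁻¹ * ∑ k, f (toPlane (scaledEigenvalue s n k ω)) := by
  rw [scaledScirc_eq, integral_esd_conj_diagonal (star_scircEigenbasis_mul_self n)]

theorem tendstoWeaklyInProbability_esd_scaledScirc {s : ℕ → Ω → ℝ}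
    (hs : StandardizedTwoPlusMoment s μ) :
    TendstoWeaklyInProbability μ (fun n ω => esd (scaledScirc s (n + 1) ω))
      (multivariateGaussian 0 (Matrix.diagonal fun _ : Fin 2 => (1 / 2 : ℝ))) := by
  intro f
  rw [← map_toPlane_stdComplexGaussianLaw, integral_map
    continuous_toPlane.measurable.aemeasurable f.continuous.aestronglyMeasurable]
  set c : ℝ := ∫ z, f (toPlane z) ∂stdComplexGaussianLaw with hc
  -- After centring, the squared deviation of `∫ f dμ_n` is a double average of `g ⊗ g` over pairs
  -- of eigenvalues, so its expectation is an integral against `pairLaw`.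
  let g : ℂ →ᵇ ℝ := f.compContinuous ⟨toPlane, continuous_toPlane⟩ -
    BoundedContinuousFunction.const _ c
  have hg : ∀ z, g z = f (toPlane z) - c := fun z => rfl
  let G : WithLp 2 (ℂ × ℂ) →ᵇ ℝ :=
    g.compContinuous ⟨fun x => x.fst, by fun_prop⟩ * g.compContinuous ⟨fun x => x.snd, by fun_prop⟩
  have hG : ∀ x, G x = g x.fst * g x.snd := fun x => rfl
  have hlim : ∫ x, G x ∂gaussianPairLaw = 0 := by
    simp_rw [hG]
    rw [integral_gaussianPairLaw_mul _ _ g.continuous g.continuous]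
    have : ∫ z, g z ∂stdComplexGaussianLaw = 0 := by
      simp_rw [hg]
      rw [integral_sub ?_ (integrable_const _)]
      · simp [hc]
      · exact (f.compContinuous ⟨toPlane, continuous_toPlane⟩).integrable _
    rw [this, zero_mul]
  have hmean : ∀ n : ℕ, ∀ ω, (∫ x, f x ∂(esd (scaledScirc s (n + 1) ω)) - c) ^ 2
      = (((n + 1) * (n + 1) : ℕ) : ℝ)⁻¹ * ∑ p : Fin (n + 1) × Fin (n + 1), G (WithLp.toLp 2
        (scaledEigenvalue s (n + 1) p.1 ω, scaledEigenvalue s (n + 1) p.2 ω)) := by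
    intro n ω
    have h1 : ∫ x, f x ∂(esd (scaledScirc s (n + 1) ω)) - c
        = ((n + 1 : ℕ) : ℝ)⁻¹ * ∑ k, g (scaledEigenvalue s (n + 1) k ω) := by
      rw [integral_esd_scaledScirc]
      simp_rw [hg]
      rw [Finset.sum_sub_distrib, mul_sub]
      congr 1
      simp only [Finset.sum_const, Finset.card_univ, Fintype.card_fin, nsmul_eq_mul]
      rw [inv_mul_cancel_left₀ (by positivity)]
    rw [h1, mul_pow, pow_two (Finset.sum _ _), Finset.sum_mul_sum, Fintype.sum_prod_type]
    simp_rw [hG]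
    push_cast
    rw [mul_inv, pow_two]
    rfl
  have hGint : ∀ n : ℕ, ∀ p : Fin (n + 1) × Fin (n + 1), Integrable (fun ω => G (WithLp.toLp 2
        (scaledEigenvalue s (n + 1) p.1 ω, scaledEigenvalue s (n + 1) p.2 ω))) μ := by
    intro n p
    refine (integrable_const ‖G‖).mono' (G.continuous.comp_aestronglyMeasurable
      (measurable_scaledEigenvalue_pair hs.measurable _ p).aestronglyMeasurable)
      (ae_of_all _ fun ω => G.norm_coe_le_norm _)
  refine tendstoInMeasure_of_tendsto_integral_sq (fun n => ?_) ?_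
  · simp_rw [hmean]
    exact (integrable_finsetSum _ fun p _ => hGint n p).const_mul _
  · have h := tendsto_integral_pairLaw hs G
    rw [hlim] at h
    refine h.congr fun n => ?_
    simp_rw [hmean]
    rw [integral_pairLaw hs.measurable _ G.continuous (hGint n), integral_const_mul,
      integral_finsetSum _ fun p _ => hGint n p, smul_eq_mul]

end GaussianLimit

/-! ### Uniform moment bounds for the eigenvalues. -/

section Moments

theorem abs_pow_le_one_add_pow {i m : ℕ} (hi : i ≤ 2 * m) (x : ℝ) : |x| ^ i ≤ 1 + x ^ (2 * m) := by
  rw [pow_mul, ← sq_abs x, ← pow_mul]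
  rcases le_total |x| 1 with h | h
  · exact (pow_le_one₀ (abs_nonneg x) h).trans (by linarith [pow_nonneg (abs_nonneg x) (2 * m)])
  · exact (pow_le_pow_right₀ h hi).trans (by linarith)

theorem abs_pow_le_sq_add_pow {i m : ℕ} (h2 : 2 ≤ i) (hi : i ≤ 2 * (m + 1)) (y : ℝ) :
    |y| ^ i ≤ y ^ 2 + y ^ (2 * (m + 1)) := by
  obtain ⟨k, rfl⟩ := Nat.exists_eq_add_of_le h2
  have := abs_pow_le_one_add_pow (i := k) (m := m) (by omega) y
  calc |y| ^ (2 + k) = y ^ 2 * |y| ^ k := by rw [pow_add, sq_abs]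
    _ ≤ y ^ 2 * (1 + y ^ (2 * m)) := by gcongr
    _ = _ := by ring

/-- In the binomial expansion the term linear in `y` is kept exactly, because it will vanish in
expectation. All terms of degree between `2` and `2 m + 2` in `y` have a common bound, and the
binomial coefficients sum to `4 ^ (m + 1)`. -/
theorem add_pow_even_le (m : ℕ) (x y : ℝ) :
    (x + y) ^ (2 * (m + 1)) ≤ x ^ (2 * (m + 1)) + 2 * (m + 1) * (x ^ (2 * m + 1) * y)
      + 4 ^ (m + 1) * ((1 + x ^ (2 * m)) * (y ^ 2 + y ^ (2 * (m + 1)))) := by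
  set Z := (1 + x ^ (2 * m)) * (y ^ 2 + y ^ (2 * (m + 1))) with hZ
  have h0 : ∀ i (z : ℝ), 0 ≤ z ^ (2 * i) := fun i z => by rw [pow_mul]; positivity
  have hZ0 : 0 ≤ Z := by
    have := h0 m x
    have := h0 (m + 1) y
    positivity
  have hsum : ∑ i ∈ Finset.range (2 * m + 1),
      x ^ i * y ^ (2 * m + 2 - i) * ((2 * m + 2).choose i : ℝ) ≤ 4 ^ (m + 1) * Z := by
    calc ∑ i ∈ Finset.range (2 * m + 1), x ^ i * y ^ (2 * m + 2 - i) * ((2 * m + 2).choose i : ℝ)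
        ≤ ∑ i ∈ Finset.range (2 * m + 1), Z * ((2 * m + 2).choose i : ℝ) := by
          refine Finset.sum_le_sum fun i hi => mul_le_mul_of_nonneg_right ?_ (by positivity)
          rw [Finset.mem_range] at hi
          refine (le_abs_self _).trans ?_
          rw [abs_mul, abs_pow, abs_pow]
          exact mul_le_mul (abs_pow_le_one_add_pow (by omega) x)
            (abs_pow_le_sq_add_pow (by omega) (by omega) y) (by positivity)
            (by linarith [h0 m x])
      _ ≤ ∑ i ∈ Finset.range (2 * m + 2 + 1), Z * ((2 * m + 2).choose i : ℝ) :=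
          Finset.sum_le_sum_of_subset_of_nonneg (Finset.range_mono (by omega))
            fun _ _ _ => by positivity
      _ = 4 ^ (m + 1) * Z := by
          rw [← Finset.mul_sum, ← Nat.cast_sum, Nat.sum_range_choose,
            show 2 * m + 2 = 2 * (m + 1) by ring, pow_mul]
          push_cast
          ring
  rw [show 2 * (m + 1) = 2 * m + 2 by ring, add_pow, Finset.sum_range_succ, Finset.sum_range_succ]
  have e1 : 2 * m + 2 - (2 * m + 1) = 1 := by omega
  have e2 : (2 * m + 2).choose (2 * m + 1) = 2 * m + 2 := Nat.choose_succ_self_right _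
  rw [e1, e2, Nat.sub_self, Nat.choose_self]
  push_cast
  rw [pow_zero, pow_one]
  linarith

variable {Ω : Type u} [MeasurableSpace Ω] {μ : Measure Ω} [IsProbabilityMeasure μ]

theorem integrable_pow_of_memLp {X : Ω → ℝ} (hX : ∀ p : ℕ, MemLp X p μ) (p : ℕ) :
    Integrable (fun ω => X ω ^ p) μ := by
  refine (hX p).integrable_norm_pow'.mono' ((hX p).aestronglyMeasurable.pow p)
    (ae_of_all _ fun ω => ?_)
  rw [norm_pow]

/-- Even moments of a sum of `n` independent centred variables with uniformly bounded moments
grow like `n ^ m`. -/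
theorem exists_integral_sum_pow_le (B : ℕ → ℝ) (m : ℕ) :
    ∃ K : ℝ, 0 ≤ K ∧ ∀ X : ℕ → Ω → ℝ, (∀ j, Measurable (X j)) → iIndepFun X μ →
      (∀ j, ∫ ω, X j ω ∂μ = 0) → (∀ j, ∀ p : ℕ, MemLp (X j) p μ) →
      (∀ j p, ∫ ω, X j ω ^ (2 * p) ∂μ ≤ B p) →
      ∀ n : ℕ, ∫ ω, (∑ j ∈ Finset.range n, X j ω) ^ (2 * m) ∂μ ≤ K * n ^ m := by
  induction m with
  | zero => exact ⟨1, zero_le_one, fun X _ _ _ _ _ n => by simp⟩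
  | succ m ih =>
    obtain ⟨K, hK, h⟩ := ih
    set D : ℝ := 4 ^ (m + 1) * (|B 1| + |B (m + 1)|) with hD
    have hD0 : 0 ≤ D := by positivity
    -- Adding one variable raises the moment of order `2 (m + 1)` by at most `D * (1 + K * n ^ m)`,
    -- with `K` the constant for the exponent `m`; summing over `n` gains one power of `n`.
    refine ⟨D * (1 + K), by positivity, fun X hm hind h0 hL hB n => ?_⟩
    have hm' := h X hm hind h0 hL hB
    have hnn : ∀ i (z : ℝ), 0 ≤ z ^ (2 * i) := fun i z => by rw [pow_mul]; positivity
    induction n with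
    | zero => simp
    | succ n ihn =>
      set T : Ω → ℝ := fun ω => ∑ j ∈ Finset.range n, X j ω with hT
      have hTL : ∀ p : ℕ, MemLp T p μ := fun p => memLp_finsetSum _ fun j _ => hL j p
      have hTi := integrable_pow_of_memLp hTL
      have hXi := integrable_pow_of_memLp (hL n)
      have hTX : IndepFun T (X n) μ := by
        have := hind.indepFun_finsetSum_of_notMem hm (s := Finset.range n) (i := n) (by simp)
        convert this using 1
        ext ω
        simp [hT]
      have hind1 : IndepFun (fun ω => T ω ^ (2 * m + 1)) (X n) μ :=
        hTX.comp (φ := fun x => x ^ (2 * m + 1)) (ψ := id) (by fun_prop) measurable_id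
      have hind2 : IndepFun (fun ω => 1 + T ω ^ (2 * m))
          (fun ω => X n ω ^ 2 + X n ω ^ (2 * (m + 1))) μ :=
        hTX.comp (φ := fun x => 1 + x ^ (2 * m)) (ψ := fun y => y ^ 2 + y ^ (2 * (m + 1)))
          (by fun_prop) (by fun_prop)
      have hX1 : Integrable (X n) μ := by simpa using hXi 1
      have hA : Integrable (fun ω => 1 + T ω ^ (2 * m)) μ := (integrable_const _).add (hTi _)
      have hA' : Integrable (fun ω => X n ω ^ 2 + X n ω ^ (2 * (m + 1))) μ := (hXi _).add (hXi _)
      have i2 : Integrable (fun ω => 2 * ((m : ℝ) + 1) * (T ω ^ (2 * m + 1) * X n ω)) μ :=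
        (hind1.integrable_mul (hTi _) hX1).const_mul _
      have i3 : Integrable (fun ω => 4 ^ (m + 1) * ((1 + T ω ^ (2 * m)) *
          (X n ω ^ 2 + X n ω ^ (2 * (m + 1))))) μ :=
        (hind2.integrable_mul hA hA').const_mul _
      have i12 : Integrable (fun ω => T ω ^ (2 * (m + 1)) +
          2 * ((m : ℝ) + 1) * (T ω ^ (2 * m + 1) * X n ω)) μ := (hTi _).add i2
      have hstep : ∫ ω, (∑ j ∈ Finset.range (n + 1), X j ω) ^ (2 * (m + 1)) ∂μ
          ≤ ∫ ω, T ω ^ (2 * (m + 1)) ∂μ + D * (1 + K * n ^ m) := by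
        calc ∫ ω, (∑ j ∈ Finset.range (n + 1), X j ω) ^ (2 * (m + 1)) ∂μ
            ≤ ∫ ω, (T ω ^ (2 * (m + 1)) + 2 * ((m : ℝ) + 1) * (T ω ^ (2 * m + 1) * X n ω)
                + 4 ^ (m + 1) * ((1 + T ω ^ (2 * m)) *
                  (X n ω ^ 2 + X n ω ^ (2 * (m + 1))))) ∂μ := by
              refine integral_mono_of_nonneg (ae_of_all _ fun ω => hnn _ _) (i12.add i3)
                (ae_of_all _ fun ω => ?_)
              simp only [Finset.sum_range_succ]
              exact add_pow_even_le m _ _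
          _ = ∫ ω, T ω ^ (2 * (m + 1)) ∂μ + 4 ^ (m + 1) * ((1 + ∫ ω, T ω ^ (2 * m) ∂μ) *
                (∫ ω, X n ω ^ 2 ∂μ + ∫ ω, X n ω ^ (2 * (m + 1)) ∂μ)) := by
              rw [integral_add i12 i3, integral_add (hTi _) i2, integral_const_mul,
                integral_const_mul,
                hind1.integral_fun_mul_eq_mul_integral (hTi _).aestronglyMeasurable
                  hX1.aestronglyMeasurable,
                hind2.integral_fun_mul_eq_mul_integral hA.aestronglyMeasurable
                  hA'.aestronglyMeasurable, h0 n,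
                integral_add (integrable_const _) (hTi _), integral_add (hXi _) (hXi _)]
              simp
          _ ≤ ∫ ω, T ω ^ (2 * (m + 1)) ∂μ + 4 ^ (m + 1) * ((1 + K * n ^ m) *
                (|B 1| + |B (m + 1)|)) := by
              have b1 : ∫ ω, X n ω ^ 2 ∂μ ≤ |B 1| := (hB n 1).trans (le_abs_self _)
              have b2 : ∫ ω, X n ω ^ (2 * (m + 1)) ∂μ ≤ |B (m + 1)| :=
                (hB n (m + 1)).trans (le_abs_self _)
              have n1 : 0 ≤ ∫ ω, X n ω ^ 2 ∂μ := integral_nonneg fun ω => sq_nonneg _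
              have n2 : 0 ≤ ∫ ω, X n ω ^ (2 * (m + 1)) ∂μ := integral_nonneg fun ω => hnn _ _
              have b3 := hm' n
              gcongr
          _ = _ := by rw [hD]; ring
      refine hstep.trans ?_
      have hn1 : (n : ℝ) ^ m ≤ ((n : ℝ) + 1) ^ m := by gcongr; linarith
      have hn2 : (1 : ℝ) ≤ ((n : ℝ) + 1) ^ m := one_le_pow₀ (by linarith [n.cast_nonneg (α := ℝ)])
      have hfin : 1 + K * (n : ℝ) ^ m ≤ (1 + K) * ((n : ℝ) + 1) ^ m := by nlinarith
      have hfin2 : (n : ℝ) ^ (m + 1) + ((n : ℝ) + 1) ^ m ≤ ((n : ℝ) + 1) ^ (m + 1) := by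
        have := mul_le_mul_of_nonneg_left hn1 n.cast_nonneg
        rw [pow_succ', pow_succ']
        linarith
      push_cast
      calc ∫ ω, T ω ^ (2 * (m + 1)) ∂μ + D * (1 + K * n ^ m)
          ≤ D * (1 + K) * n ^ (m + 1) + D * ((1 + K) * ((n : ℝ) + 1) ^ m) := by gcongr
        _ = D * (1 + K) * ((n : ℝ) ^ (m + 1) + ((n : ℝ) + 1) ^ m) := by ring
        _ ≤ D * (1 + K) * ((n : ℝ) + 1) ^ (m + 1) := by gcongr

omit [IsProbabilityMeasure μ] in
theorem StandardizedAllMoments.memLp {s : ℕ → Ω → ℝ} (hs : StandardizedAllMoments s μ) (j p : ℕ) :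
    MemLp (s j) p μ := by
  rcases Nat.eq_zero_or_pos p with rfl | hp
  · simpa using (hs.measurable j).aestronglyMeasurable
  · refine ⟨(hs.measurable j).aestronglyMeasurable, ?_⟩
    obtain ⟨C, hC⟩ := hs.moments_bdd p
    rw [eLpNorm_lt_top_iff_lintegral_rpow_enorm_lt_top (by simp; omega) (by simp)]
    simpa using (hC j).trans_lt ENNReal.coe_lt_top

omit [IsProbabilityMeasure μ] in
theorem StandardizedAllMoments.exists_integral_pow_le {s : ℕ → Ω → ℝ}
    (hs : StandardizedAllMoments s μ) :
    ∃ B : ℕ → ℝ, ∀ j p, ∫ ω, s j ω ^ (2 * p) ∂μ ≤ B p := by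
  choose C hC using hs.moments_bdd
  refine ⟨fun p => C (2 * p), fun j p => ?_⟩
  have hn : 0 ≤ᵐ[μ] fun ω => s j ω ^ (2 * p) :=
    ae_of_all _ fun ω => (even_two_mul p).pow_nonneg _
  rw [integral_eq_lintegral_of_nonneg_ae hn ((hs.measurable j).pow_const _).aestronglyMeasurable]
  refine ENNReal.toReal_le_of_le_ofReal (by positivity) ?_
  rw [ENNReal.ofReal_coe_nnreal]
  refine le_trans (lintegral_mono fun ω => ?_) (hC (2 * p) j)
  rw [← enorm_pow, Real.enorm_eq_ofReal_abs]
  exact ENNReal.ofReal_le_ofReal (le_abs_self _)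

/-- Even moments of `n^{-1/2} ∑ c_j s_j` are bounded uniformly in the weights `|c_j| ≤ 1`. -/
theorem StandardizedAllMoments.exists_integral_weighted_sum_pow_le {s : ℕ → Ω → ℝ}
    (hs : StandardizedAllMoments s μ) (m : ℕ) :
    ∃ K : ℝ, ∀ n : ℕ, n ≠ 0 → ∀ c : ℕ → ℝ, (∀ j, |c j| ≤ 1) →
      ∫ ω, ((Real.sqrt n)⁻¹ * ∑ j : Fin n, c j * s j ω) ^ (2 * m) ∂μ ≤ K := by
  obtain ⟨B, hB⟩ := hs.exists_integral_pow_le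
  obtain ⟨K, hK, h⟩ := exists_integral_sum_pow_le (μ := μ) B m
  refine ⟨K, fun n hn c hc => ?_⟩
  have hL : ∀ j, ∀ p : ℕ, MemLp (fun ω => c j * s j ω) p μ := fun j p => (hs.memLp j p).const_mul _
  have hX := h (fun j ω => c j * s j ω) (fun j => (hs.measurable j).const_mul _)
    (hs.indep.comp (fun j x => c j * x) fun j => by fun_prop)
    (fun j => by rw [integral_const_mul, hs.mean_zero, mul_zero]) hL
    (fun j p => by
      refine (integral_mono (integrable_pow_of_memLp (hL j) _)
        (integrable_pow_of_memLp (hs.memLp j) _) fun ω => ?_).trans (hB j p)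
      simp only [mul_pow]
      refine mul_le_of_le_one_left (by rw [pow_mul]; positivity) ?_
      rw [pow_mul, ← sq_abs, ← pow_mul]
      exact pow_le_one₀ (abs_nonneg _) (hc j)) n
  have hn' : (0 : ℝ) < n := by exact_mod_cast Nat.pos_of_ne_zero hn
  simp_rw [mul_pow]
  rw [integral_const_mul, pow_mul, inv_pow, Real.sq_sqrt hn'.le]
  have e : ∀ ω, ∑ j : Fin n, c j * s j ω = ∑ j ∈ Finset.range n, c j * s j ω := fun ω =>
    Fin.sum_univ_eq_sum_range (fun j => c j * s j ω) n
  simp_rw [e]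
  rw [inv_pow, inv_mul_le_iff₀ (by positivity)]
  linarith

omit [IsProbabilityMeasure μ] in
theorem StandardizedAllMoments.memLp_scaledEigenvalue {s : ℕ → Ω → ℝ}
    (hs : StandardizedAllMoments s μ) (n : ℕ) (k : Fin n) (p : ℕ) :
    MemLp (scaledEigenvalue s n k) p μ := by
  have h1 : ∀ j : Fin n, MemLp (fun ω => ((s j ω : ℝ) : ℂ) * rootNegOne n k ^ (j : ℕ)) p μ :=
    fun j => MemLp.mul_const (f := fun ω => ((s j ω : ℝ) : ℂ)) (hs.memLp j p).ofReal _
  exact (memLp_finsetSum Finset.univ fun j _ => h1 j).const_mul _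

/-- Real and imaginary parts are weighted sums with weights bounded by `1`, since `|ζ| = 1`;
convexity of `x ^ m` recombines them. -/
theorem StandardizedAllMoments.exists_integral_norm_scaledEigenvalue_pow_le {s : ℕ → Ω → ℝ}
    (hs : StandardizedAllMoments s μ) (m : ℕ) :
    ∃ K : ℝ, ∀ n : ℕ, ∀ k : Fin n, ∫ ω, ‖scaledEigenvalue s n k ω‖ ^ (2 * m) ∂μ ≤ K := by
  obtain ⟨K, hK⟩ := hs.exists_integral_weighted_sum_pow_le m
  refine ⟨2 ^ (m - 1) * (K + K), fun n k => ?_⟩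
  have hn : n ≠ 0 := by have := k.2; omega
  have hre : ∀ ω, (scaledEigenvalue s n k ω).re
      = (Real.sqrt n)⁻¹ * ∑ j : Fin n, (rootNegOne n k ^ (j : ℕ)).re * s j ω := by
    intro ω
    rw [scaledEigenvalue, scircEigenvalue, Complex.re_ofReal_mul, Complex.re_sum]
    simp_rw [Complex.re_ofReal_mul, mul_comm]
  have him : ∀ ω, (scaledEigenvalue s n k ω).im
      = (Real.sqrt n)⁻¹ * ∑ j : Fin n, (rootNegOne n k ^ (j : ℕ)).im * s j ω := by
    intro ω
    rw [scaledEigenvalue, scircEigenvalue, Complex.im_ofReal_mul, Complex.im_sum]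
    simp_rw [Complex.im_ofReal_mul, mul_comm]
  have hnorm : ∀ j : ℕ, ‖rootNegOne n k ^ j‖ = 1 := fun j => by
    rw [norm_pow, norm_rootNegOne, one_pow]
  have h1 := hK n hn (fun j => (rootNegOne n k ^ j).re)
    fun j => (Complex.abs_re_le_norm _).trans_eq (hnorm j)
  have h2 := hK n hn (fun j => (rootNegOne n k ^ j).im)
    fun j => (Complex.abs_im_le_norm _).trans_eq (hnorm j)
  simp_rw [← hre] at h1
  simp_rw [← him] at h2
  have i1 := integrable_pow_of_memLp (fun p => (hs.memLp_scaledEigenvalue n k p).re) (2 * m)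
  have i2 := integrable_pow_of_memLp (fun p => (hs.memLp_scaledEigenvalue n k p).im) (2 * m)
  calc ∫ ω, ‖scaledEigenvalue s n k ω‖ ^ (2 * m) ∂μ
      ≤ ∫ ω, 2 ^ (m - 1) * ((scaledEigenvalue s n k ω).re ^ (2 * m)
          + (scaledEigenvalue s n k ω).im ^ (2 * m)) ∂μ := by
        refine integral_mono_of_nonneg (ae_of_all _ fun ω => by positivity)
          ((i1.add i2).const_mul _) (ae_of_all _ fun ω => ?_)
        simp only [pow_mul]
        rw [← Complex.normSq_eq_norm_sq, Complex.normSq_apply, ← pow_two, ← pow_two]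
        exact add_pow_le (sq_nonneg _) (sq_nonneg _) m
    _ = 2 ^ (m - 1) * (∫ ω, (scaledEigenvalue s n k ω).re ^ (2 * m) ∂μ
          + ∫ ω, (scaledEigenvalue s n k ω).im ^ (2 * m) ∂μ) := by
        rw [integral_const_mul]
        congr 1
        exact integral_add i1 i2
    _ ≤ 2 ^ (m - 1) * (K + K) := by gcongr

end Moments

/-! ### From bounded to square-integrable test functions. -/

section UniformIntegrability

variable {E : Type*} [TopologicalSpace E] [MeasurableSpace E] [OpensMeasurableSpace E]

/-- Truncation at level `R` of a continuous function. -/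
noncomputable def clip (f : C(E, ℝ)) (R : ℝ) (hR : 0 ≤ R) : E →ᵇ ℝ :=
  BoundedContinuousFunction.ofNormedAddCommGroup (fun x => max (-R) (min R (f x)))
    (by fun_prop) R fun x => by
      rw [Real.norm_eq_abs, abs_le]
      exact ⟨le_max_left _ _, max_le (by linarith) (min_le_left _ _)⟩

omit [MeasurableSpace E] [OpensMeasurableSpace E] in
-- The error vanishes where `|f| ≤ R`, and elsewhere it is at most `|f| ≤ f ^ 2 / R`.
theorem abs_sub_clip_le (f : C(E, ℝ)) {R : ℝ} (hR : 0 < R) (x : E) :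
    |f x - clip f R hR.le x| ≤ R⁻¹ * f x ^ 2 := by
  change |f x - max (-R) (min R (f x))| ≤ _
  rw [inv_mul_eq_div, le_div_iff₀ hR]
  rcases le_total R (f x) with h | h
  · rw [min_eq_left h, max_eq_right (by linarith), abs_of_nonneg (by linarith)]
    nlinarith
  · rw [min_eq_right h]
    rcases le_total (-R) (f x) with h' | h'
    · rw [max_eq_right h', sub_self, abs_zero, zero_mul]
      positivity
    · rw [max_eq_left h', abs_of_nonpos (by linarith)]
      nlinarith

theorem abs_integral_sub_integral_clip_le {ν : Measure E} [IsProbabilityMeasure ν] {f : C(E, ℝ)}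
    {B : ℝ} (hint : Integrable (fun x => f x ^ 2) ν) (hB : ∫ x, f x ^ 2 ∂ν ≤ B)
    {R : ℝ} (hR : 0 < R) :
    |∫ x, f x ∂ν - ∫ x, clip f R hR.le x ∂ν| ≤ R⁻¹ * B := by
  have hf : Integrable f ν := ((memLp_two_iff_integrable_sq
    f.continuous.measurable.aestronglyMeasurable).2 hint).integrable (by norm_num)
  rw [← integral_sub hf ((clip f R hR.le).integrable ν), ← Real.norm_eq_abs]
  refine (norm_integral_le_of_norm_le (hint.const_mul R⁻¹)
    (ae_of_all _ fun x => abs_sub_clip_le f hR x)).trans ?_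
  rw [integral_const_mul]
  gcongr

/-- Bounded second moments make the truncation error small uniformly in `n`, while the truncated
function is bounded and continuous. -/
theorem tendsto_integral_of_integral_sq_le {ν : ℕ → Measure E} {γ : Measure E}
    [∀ n, IsProbabilityMeasure (ν n)] [IsProbabilityMeasure γ]
    (h : ∀ f : E →ᵇ ℝ, Tendsto (fun n => ∫ x, f x ∂(ν n)) atTop (𝓝 (∫ x, f x ∂γ)))
    (f : C(E, ℝ)) {B : ℝ} (hint : ∀ n, Integrable (fun x => f x ^ 2) (ν n))
    (hB : ∀ n, ∫ x, f x ^ 2 ∂(ν n) ≤ B) (hγ : Integrable (fun x => f x ^ 2) γ) :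
    Tendsto (fun n => ∫ x, f x ∂(ν n)) atTop (𝓝 (∫ x, f x ∂γ)) := by
  rw [Metric.tendsto_atTop]
  intro ε hε
  set M := max B (∫ x, f x ^ 2 ∂γ) with hM
  have hM0 : 0 ≤ M := le_max_of_le_right (integral_nonneg fun x => sq_nonneg _)
  -- Makes each of the two truncation errors smaller than `ε / 3`; the `+ 1` covers `M = 0`.
  set R := 4 * (M + 1) / ε with hRdef
  have hR : 0 < R := by positivity
  have hRM : R⁻¹ * M < ε / 3 := by
    rw [hRdef, inv_div, div_mul_eq_mul_div, div_lt_div_iff₀ (by positivity) (by norm_num)]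
    nlinarith
  obtain ⟨N, hN⟩ := Metric.tendsto_atTop.1 (h (clip f R hR.le)) (ε / 3) (by positivity)
  refine ⟨N, fun n hn => ?_⟩
  have h1 := abs_integral_sub_integral_clip_le (B := M) (hint n)
    ((hB n).trans (le_max_left _ _)) hR
  have h2 := abs_integral_sub_integral_clip_le (B := M) hγ (le_max_right _ _) hR
  have h3 := hN n hn
  rw [Real.dist_eq] at h3 ⊢
  rw [abs_lt] at *
  rw [abs_le] at h1 h2
  constructor <;> linarith

end UniformIntegrability

/-! ### Convergence in `*`-distribution, claim (i). -/

section StarDistribution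

theorem norm_monomialEval (w : List Bool) (z : ℂ) : ‖monomialEval w z‖ = ‖z‖ ^ w.length := by
  induction w with
  | nil => simp [monomialEval_nil]
  | cons b w ih =>
    rw [monomialEval_cons, norm_mul, ih, List.length_cons, pow_succ']
    cases b <;> simp

theorem continuous_monomialEval (w : List Bool) : Continuous (monomialEval w : ℂ → ℂ) := by
  induction w with
  | nil =>
    simp only [funext fun z : ℂ => monomialEval_nil z]
    exact continuous_const
  | cons b w ih =>
    simp only [funext fun z : ℂ => monomialEval_cons b w z]
    cases b
    · exact continuous_id.mul ih
    · exact continuous_star.mul ih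

variable {Ω : Type u} [MeasurableSpace Ω] {μ : Measure Ω} [IsProbabilityMeasure μ]

/-- The random matrix underlying an element of `(ℳ_n, n⁻¹ E Tr)`. -/
def toRandomMatrix {n : ℕ} [NeZero n] (X : randomMatrixNCP μ n) : Ω → Matrix (Fin n) (Fin n) ℂ :=
  Subtype.val (p := fun Y => Y ∈ momentMatrices μ n) X

theorem toRandomMatrix_injective {n : ℕ} [NeZero n] :
    Function.Injective (toRandomMatrix (μ := μ) (n := n)) :=
  Subtype.val_injective

theorem toRandomMatrix_one {n : ℕ} [NeZero n] (ω : Ω) :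
    toRandomMatrix (1 : randomMatrixNCP μ n) ω = 1 := rfl

theorem toRandomMatrix_mul {n : ℕ} [NeZero n] (X Y : randomMatrixNCP μ n) (ω : Ω) :
    toRandomMatrix (X * Y) ω = toRandomMatrix X ω * toRandomMatrix Y ω := rfl

theorem toRandomMatrix_star {n : ℕ} [NeZero n] (X : randomMatrixNCP μ n) (ω : Ω) :
    toRandomMatrix (star X) ω = star (toRandomMatrix X ω) := rfl

theorem state_randomMatrixNCP {n : ℕ} [NeZero n] (X : randomMatrixNCP μ n) :
    (randomMatrixNCP μ n).state X = (n : ℂ)⁻¹ * ∫ ω, (toRandomMatrix X ω).trace ∂μ := rfl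

theorem toRandomMatrix_monomialEval {n : ℕ} [NeZero n] (X : randomMatrixNCP μ n)
    (w : List Bool) (ω : Ω) :
    toRandomMatrix (monomialEval w X) ω = monomialEval w (toRandomMatrix X ω) := by
  induction w with
  | nil => rw [monomialEval_nil, monomialEval_nil, toRandomMatrix_one]
  | cons b w ih =>
    rw [monomialEval_cons, monomialEval_cons, toRandomMatrix_mul, ih]
    cases b
    · simp
    · simp [toRandomMatrix_star]

theorem memLp_id_stdComplexGaussianLaw (p : ℕ) :
    MemLp (fun z : ℂ => z) p stdComplexGaussianLaw := by
  have hm : Measurable fun p : ℝ × ℝ => (p.1 : ℂ) + (p.2 : ℂ) * Complex.I := by fun_prop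
  rw [stdComplexGaussianLaw, memLp_map_measure_iff (g := fun z : ℂ => z)
    measurable_id.aestronglyMeasurable hm.aemeasurable]
  have h : MemLp (fun x : ℝ => (x : ℂ)) p (gaussianReal 0 (1 / 2)) :=
    (memLp_id_gaussianReal' (p : ℝ≥0∞) (by simp)).ofReal
  exact (h.comp_fst _).add ((h.comp_snd _).mul_const _)

/-- The identity variable of the standard complex Gaussian law, as a `1 × 1` random matrix. -/
noncomputable def gaussianVariable : randomMatrixNCP stdComplexGaussianLaw 1 :=
  ⟨fun z => Matrix.diagonal fun _ => z, fun i j p => by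
    rw [Subsingleton.elim i j]
    simpa using memLp_id_stdComplexGaussianLaw p⟩

theorem toRandomMatrix_gaussianVariable (z : ℂ) :
    toRandomMatrix gaussianVariable z = Matrix.diagonal fun _ => z := rfl

theorem state_monomialEval_gaussianVariable (w : List Bool) :
    (randomMatrixNCP stdComplexGaussianLaw 1).state (monomialEval w gaussianVariable)
      = ∫ z, monomialEval w z ∂stdComplexGaussianLaw := by
  simp [state_randomMatrixNCP, toRandomMatrix_monomialEval, toRandomMatrix_gaussianVariable,
    monomialEval_diagonal]

theorem monomialEval_replicate {A : Type*} [Monoid A] [Star A] (k l : ℕ) (a : A) :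
    monomialEval (List.replicate k false ++ List.replicate l true) a = a ^ k * star a ^ l := by
  simp [monomialEval]

theorem isStdComplexGaussian_gaussianVariable :
    IsStdComplexGaussian (randomMatrixNCP stdComplexGaussianLaw 1) gaussianVariable where
  normal := by
    refine toRandomMatrix_injective (funext fun z => ?_)
    simp only [toRandomMatrix_mul, toRandomMatrix_star, toRandomMatrix_gaussianVariable,
      Matrix.star_eq_conjTranspose, Matrix.diagonal_conjTranspose, Matrix.diagonal_mul_diagonal,
      mul_comm]
  not_selfAdjoint := by
    intro h
    -- Elements are functions, not classes modulo null sets, so evaluation at the single sample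
    -- point `i` distinguishes the variable from its adjoint.
    have h1 := congrArg (fun X => toRandomMatrix X Complex.I 0 0) h
    have h2 := congrArg Complex.im h1
    norm_num [toRandomMatrix_star, toRandomMatrix_gaussianVariable, Matrix.star_apply] at h2
  moments := by
    intro k l
    rw [← monomialEval_replicate, state_monomialEval_gaussianVariable]
    simp_rw [monomialEval_replicate]
    rfl

theorem StandardizedAllMoments.integrable_monomialEval {s : ℕ → Ω → ℝ}
    (hs : StandardizedAllMoments s μ) (w : List Bool) {n : ℕ} (k : Fin n) :
    Integrable (fun ω => monomialEval w (scaledEigenvalue s n k ω)) μ := by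
  refine (hs.memLp_scaledEigenvalue n k w.length).integrable_norm_pow'.mono'
    ((continuous_monomialEval w).comp_aestronglyMeasurable
      (hs.memLp_scaledEigenvalue n k 0).aestronglyMeasurable) (ae_of_all _ fun ω => ?_)
  rw [norm_monomialEval]

/-- The trace is a sum over single eigenvalues; averaging over an idle second index turns it into an
integral against `pairLaw`, so one weak limit serves both claims. -/
theorem StandardizedAllMoments.state_monomialEval_scaledScircElem {s : ℕ → Ω → ℝ}
    (hs : StandardizedAllMoments s μ) (w : List Bool) (n : ℕ) [NeZero n] :
    (randomMatrixNCP μ n).state (monomialEval w (scaledScircElem hs n))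
      = ∫ x, monomialEval w x.fst ∂(pairLaw s μ n) := by
  have h : ∀ ω, (toRandomMatrix (monomialEval w (scaledScircElem hs n)) ω).trace
      = ∑ k, monomialEval w (scaledEigenvalue s n k ω) := by
    intro ω
    rw [toRandomMatrix_monomialEval]
    change (monomialEval w (scaledScirc s n ω)).trace = _
    rw [scaledScirc_eq, trace_monomialEval_conj_diagonal (star_scircEigenbasis_mul_self n)]
  simp_rw [state_randomMatrixNCP, h]
  rw [integral_finsetSum _ fun k _ => hs.integrable_monomialEval w k,
    integral_pairLaw (f := fun x => monomialEval w x.fst) hs.measurable n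
      ((continuous_monomialEval w).comp (by fun_prop))
      fun p => hs.integrable_monomialEval w p.1, Fintype.sum_prod_type]
  have hn : (n : ℂ) ≠ 0 := NeZero.ne _
  simp only [WithLp.toLp_fst, Finset.sum_const, Finset.card_univ, Fintype.card_fin, nsmul_eq_mul,
    ← Finset.mul_sum, Complex.real_smul]
  push_cast
  field_simp

/-- Polynomial growth gives `f ^ 2 ≤ ‖z‖ ^ (2 m)`, whose means are bounded uniformly in `n`, so the
weak limit extends to `f`. -/
theorem StandardizedAllMoments.tendsto_integral_pairLaw_of_abs_le {s : ℕ → Ω → ℝ}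
    (hs : StandardizedAllMoments s μ) {m : ℕ} {f : ℂ → ℝ} (hf : Continuous f)
    (hle : ∀ z, |f z| ≤ ‖z‖ ^ m) :
    Tendsto (fun n => ∫ x, f x.fst ∂(pairLaw s μ (n + 1))) atTop
      (𝓝 (∫ z, f z ∂stdComplexGaussianLaw)) := by
  have hg : ∫ x, f x.fst ∂gaussianPairLaw = ∫ z, f z ∂stdComplexGaussianLaw := by
    simpa using integral_gaussianPairLaw_mul f (fun _ => 1) hf continuous_const
  rw [← hg]
  have hsq : ∀ z, f z ^ 2 ≤ ‖z‖ ^ (2 * m) := by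
    intro z
    rw [← sq_abs, mul_comm, pow_mul]
    exact pow_le_pow_left₀ (abs_nonneg _) (hle z) 2
  have := fun n : ℕ => isProbabilityMeasure_pairLaw (μ := μ) hs.measurable n.succ_ne_zero
  have hnorm : Continuous fun x : WithLp 2 (ℂ × ℂ) => ‖x.fst‖ ^ (2 * m) := by fun_prop
  have hsqc : Continuous fun x : WithLp 2 (ℂ × ℂ) => f x.fst ^ 2 :=
    (hf.comp (by fun_prop)).pow 2
  have hdom : ∀ ν : Measure (WithLp 2 (ℂ × ℂ)),
      Integrable (fun x : WithLp 2 (ℂ × ℂ) => ‖x.fst‖ ^ (2 * m)) ν →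
      Integrable (fun x : WithLp 2 (ℂ × ℂ) => f x.fst ^ 2) ν := fun ν h =>
    h.mono' hsqc.aestronglyMeasurable (ae_of_all _ fun x => by
      rw [Real.norm_of_nonneg (sq_nonneg _)]
      exact hsq _)
  have hint : ∀ (n : ℕ) (p : Fin (n + 1) × Fin (n + 1)),
      Integrable (fun ω => ‖scaledEigenvalue s (n + 1) p.1 ω‖ ^ (2 * m)) μ := fun n p =>
    (hs.memLp_scaledEigenvalue (n + 1) p.1 (2 * m)).integrable_norm_pow'
  have hν : ∀ n : ℕ, Integrable (fun x : WithLp 2 (ℂ × ℂ) => ‖x.fst‖ ^ (2 * m))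
      (pairLaw s μ (n + 1)) := fun n =>
    integrable_pairLaw hs.measurable n.succ_ne_zero hnorm (hint n)
  obtain ⟨K, hK⟩ := hs.exists_integral_norm_scaledEigenvalue_pow_le m
  refine tendsto_integral_of_integral_sq_le
    (tendsto_integral_pairLaw hs.standardizedTwoPlusMoment)
    ⟨fun x : WithLp 2 (ℂ × ℂ) => f x.fst, hf.comp (by fun_prop)⟩ (B := K)
    (fun n => hdom _ (hν n)) (fun n => ?_) (hdom _ ?_)
  · refine (integral_mono (hdom _ (hν n)) (hν n) fun x => hsq x.fst).trans ?_
    rw [integral_pairLaw hs.measurable _ hnorm (hint n), smul_eq_mul,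
      inv_mul_le_iff₀ (by positivity)]
    refine (Finset.sum_le_card_nsmul _ _ K fun p _ => hK _ p.1).trans_eq ?_
    simp
  · rw [gaussianPairLaw, integrable_map_measure hnorm.aestronglyMeasurable (by fun_prop)]
    exact ((memLp_id_stdComplexGaussianLaw (2 * m)).comp_fst
      stdComplexGaussianLaw).integrable_norm_pow'

theorem StandardizedAllMoments.tendstoInStarDistribution {s : ℕ → Ω → ℝ}
    (hs : StandardizedAllMoments s μ) :
    TendstoInStarDistribution (fun n => randomMatrixNCP μ (n + 1))
      (fun n => scaledScircElem hs (n + 1)) (randomMatrixNCP stdComplexGaussianLaw 1)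
      gaussianVariable := by
  intro w
  have hc := continuous_monomialEval w
  simp_rw [hs.state_monomialEval_scaledScircElem]
  rw [state_monomialEval_gaussianVariable]
  have hre := hs.tendsto_integral_pairLaw_of_abs_le (m := w.length)
    (f := fun z => (monomialEval w z).re) (Complex.continuous_re.comp hc)
    fun z => (Complex.abs_re_le_norm _).trans_eq (norm_monomialEval w z)
  have him := hs.tendsto_integral_pairLaw_of_abs_le (m := w.length)
    (f := fun z => (monomialEval w z).im) (Complex.continuous_im.comp hc)
    fun z => (Complex.abs_im_le_norm _).trans_eq (norm_monomialEval w z)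
  have hν : ∀ n : ℕ, Integrable (fun x : WithLp 2 (ℂ × ℂ) => monomialEval w x.fst)
      (pairLaw s μ (n + 1)) := fun n =>
    integrable_pairLaw (f := fun x => monomialEval w x.fst) hs.measurable n.succ_ne_zero
      (hc.comp (by fun_prop)) fun p => hs.integrable_monomialEval w p.1
  have hγ : Integrable (fun z => monomialEval w z) stdComplexGaussianLaw := by
    refine (memLp_id_stdComplexGaussianLaw w.length).integrable_norm_pow'.mono'
      hc.aestronglyMeasurable (ae_of_all _ fun z => (norm_monomialEval w z).le)
  -- The convergence result is for real functions, so the real and imaginary parts are treated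
  -- separately.
  rw [← integral_re_add_im hγ]
  simp_rw [fun n => (integral_re_add_im (hν n)).symm]
  exact ((Complex.continuous_ofReal.tendsto _).comp hre).add
    (((Complex.continuous_ofReal.tendsto _).comp him).mul_const _)

end StarDistribution

end SkewCirculant

open SkewCirculant
theorem theorem3p1 {Ω : Type u} [MeasurableSpace Ω] (μ : Measure Ω) [IsProbabilityMeasure μ]
    (s : ℕ → Ω → ℝ) :
    (∀ hs : StandardizedAllMoments s μ, ∃ (𝒜 : NCP.{0}) (a : 𝒜), IsStdComplexGaussian 𝒜 a ∧
      TendstoInStarDistribution (fun n => randomMatrixNCP μ (n + 1))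
        (fun n => scaledScircElem hs (n + 1)) 𝒜 a) ∧
    (StandardizedTwoPlusMoment s μ →
      TendstoWeaklyInProbability μ (fun n ω => esd (scaledScirc s (n + 1) ω))
        (multivariateGaussian 0 (Matrix.diagonal fun _ : Fin 2 => (1 / 2 : ℝ)))) :=
  ⟨fun hs => ⟨_, gaussianVariable, isStdComplexGaussian_gaussianVariable,
    hs.tendstoInStarDistribution⟩, tendstoWeaklyInProbability_esd_scaledScirc⟩
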